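/- A biased graph is a pair $(G,\mathcal B)$ where $G$ is a finite graph (loops and parallel edges allowed) and $\mathcal B$ is a set of cycles of $G$, called balanced, such that no theta subgraph of $G$ contains exactly two cycles in $\mathcal B$; cycles not in $\mathcal B$ are unbalanced. Loops count as cycles of length one and pairs of parallel non-loop edges as cycles of length two (2-cycles). The lift matroid $L(G,\mathcal B)$ is the matroid on $E(G)$ whose circuits are the balanced cycles, the theta subgraphs with all cycles unbalanced, the unions of two edge-disjoint unbalanced cycles with exactly one common vertex, and the unions of two vertex-disjoint unbalanced cycles. The simplification $\mathrm{si}(G)$ is obtained from $G$ by deleting all loops and all but one edge from each maximal set of parallel edges. A matroid is simple if it has no circuit with at most two elements, connected if every two distinct elements lie in a common circuit, and unbreakable if it is connected and $M/F$ is connected for every flat $F$ of $M$; it is 3-connected if for $k\in\{1,2\}$ there is no partition $(X,Y)$ of its ground set with $|X|,|Y|\ge k$ and $r(X)+r(Y)-r(M)<k$. **Theorem.** Let $M=L(G,\mathcal B)$ be a lifted-graphic matroid on a graph $G$ such that $\mathrm{si}(G)$ is a cycle and $|V(G)|>6$. Then $M$ is 3-connected if and only if $M$ is simple and at most one non-loop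 edge of $G$ lies in no 2-cycle of $G$. Moreover, if $M$ is 3-connected, then $M$ is unbreakable. -/

import Mathlib

/-! Multigraphs are Mathlib's `Graph α β` (vertices in `α`, edges in `β`, loops and parallel edges
allowed). Subgraphs without isolated vertices are given by their edge sets. -/

namespace Graph

variable {α β : Type*}

/-- The vertex set of `G[X]`: all ends of edges in `X`. -/
def endSet (G : Graph α β) (X : Set β) : Set α := {x | ∃ e ∈ X, G.Inc e x}

/-- `C` is the edge set of a cycle of `G`: there are `n + 1 ≥ 1` distinct vertices `v 0, …, v n` and
distinct edges `e 0, …, e n`, where `e i` joins `v i` to `v (i + 1)`, indices modulo `n + 1`.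
Loops are the cycles of length one, and pairs of parallel edges are the cycles of length two. -/
def IsCycle (G : Graph α β) (C : Set β) : Prop :=
  ∃ (n : ℕ) (v : Fin (n + 1) → α) (e : Fin (n + 1) → β),
    Function.Injective v ∧ Function.Injective e ∧
      (∀ i, G.IsLink (e i) (v i) (v (i + 1))) ∧ C = Set.range e

/-- `P` is the edge set of a path of `G` (no repeated vertices) from `x` to `y`. -/
def IsPathBetween (G : Graph α β) (x y : α) (P : Set β) : Prop :=
  ∃ (n : ℕ) (v : Fin (n + 1) → α) (e : Fin n → β),
    Function.Injective v ∧ v 0 = x ∧ v (Fin.last n) = y ∧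
      (∀ i, G.IsLink (e i) (v i.castSucc) (v i.succ)) ∧ P = Set.range e

/-- `P`, `Q`, `R` are the edge sets of three internally vertex-disjoint paths between two distinct
vertices. Thus `P ∪ Q ∪ R` is a theta subgraph, and its cycles are `P ∪ Q`, `Q ∪ R` and `P ∪ R`. -/
def IsTheta (G : Graph α β) (P Q R : Set β) : Prop :=
  ∃ x y, x ≠ y ∧
    G.IsPathBetween x y P ∧ G.IsPathBetween x y Q ∧ G.IsPathBetween x y R ∧
    Disjoint P Q ∧ Disjoint Q R ∧ Disjoint P R ∧
    G.endSet P ∩ G.endSet Q = {x, y} ∧ G.endSet Q ∩ G.endSet R = {x, y} ∧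
    G.endSet P ∩ G.endSet R = {x, y}

/-- `(G, 𝓑)` is a biased graph: `𝓑` consists of cycles of `G`, and no theta subgraph contains exactly
two members of `𝓑`. (In `theta` the three paths may be permuted, so it forbids every way
of having exactly two of the three cycles in `𝓑`.) -/
structure IsBiased (G : Graph α β) (𝓑 : Set (Set β)) : Prop where
  isCycle : ∀ C ∈ 𝓑, G.IsCycle C
  theta : ∀ P Q R, G.IsTheta P Q R → P ∪ Q ∈ 𝓑 → Q ∪ R ∈ 𝓑 → P ∪ R ∈ 𝓑

/-- `C` is an unbalanced cycle of `(G, 𝓑)`. -/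
def IsUnbalancedCycle (G : Graph α β) (𝓑 : Set (Set β)) (C : Set β) : Prop :=
  G.IsCycle C ∧ C ∉ 𝓑

/-- The circuits of the lift matroid of `(G, 𝓑)`: balanced cycles, thetas with all cycles unbalanced,
tight handcuffs (two edge-disjoint cycles with exactly one common vertex) with both cycles
unbalanced, and unions of two vertex-disjoint unbalanced cycles. -/
inductive IsLiftCircuit (G : Graph α β) (𝓑 : Set (Set β)) : Set β → Prop
  | balanced (C : Set β) (hC : C ∈ 𝓑) : IsLiftCircuit G 𝓑 C
  | theta (P Q R : Set β) (h : G.IsTheta P Q R) (hPQ : P ∪ Q ∉ 𝓑) (hQR : Q ∪ R ∉ 𝓑)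
      (hPR : P ∪ R ∉ 𝓑) : IsLiftCircuit G 𝓑 (P ∪ Q ∪ R)
  | tightHandcuff (C D : Set β) (hC : G.IsUnbalancedCycle 𝓑 C) (hD : G.IsUnbalancedCycle 𝓑 D)
      (hCD : Disjoint C D) (x : α) (hx : G.endSet C ∩ G.endSet D = {x}) : IsLiftCircuit G 𝓑 (C ∪ D)
  | disjointCycles (C D : Set β) (hC : G.IsUnbalancedCycle 𝓑 C) (hD : G.IsUnbalancedCycle 𝓑 D)
      (hCD : Disjoint (G.endSet C) (G.endSet D)) : IsLiftCircuit G 𝓑 (C ∪ D)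

/-- `M` is the lift matroid of `(G, 𝓑)`: the matroid on `E(G)` with the above circuits. -/
def IsLiftMatroid (G : Graph α β) (𝓑 : Set (Set β)) (M : Matroid β) : Prop :=
  M.E = G.edgeSet ∧ ∀ C, M.IsCircuit C ↔ G.IsLiftCircuit 𝓑 C

/-- `H` is a simplification of `G`: it is obtained from `G` by deleting all loops and all but one edge
of each maximal set of parallel edges. -/
def IsSimplificationOf (H G : Graph α β) : Prop :=
  H.IsSpanningSubgraph G ∧ H.Simple ∧ ∀ x y, x ≠ y → G.Adj x y → H.Adj x y

/-- `si(G)` is a cycle: some (equivalently every) simplification of `G` consists of a cycle through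
all of its vertices and has no further edges. -/
def SimplificationIsCycle (G : Graph α β) : Prop :=
  ∃ H : Graph α β, H.IsSimplificationOf G ∧ H.IsCycle H.edgeSet ∧ H.endSet H.edgeSet = H.vertexSet

/-- The non-loop edges of `G` that lie in no cycle of length two. -/
def nonloopsInNoTwoCycle (G : Graph α β) : Set β :=
  {e ∈ G.edgeSet | (∀ x, ¬ G.IsLoopAt e x) ∧ ¬ ∃ C, G.IsCycle C ∧ C.encard = 2 ∧ e ∈ C}

end Graph

namespace Matroid

variable {α β : Type*}

/-- `M` is a lifted-graphic matroid on the graph `G`: it is the lift matroid of `(G, 𝓑)` for some set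
`𝓑` of balanced cycles. -/
def IsLiftedGraphicOn (M : Matroid β) (G : Graph α β) : Prop :=
  ∃ 𝓑 : Set (Set β), G.IsBiased 𝓑 ∧ G.IsLiftMatroid 𝓑 M

/-- No loops and no parallel pairs, i.e. no circuit with at most two elements. -/
def IsSimple (M : Matroid β) : Prop := ∀ C, M.IsCircuit C → 2 < C.encard

/-- Every two distinct elements lie in a common circuit. -/
def IsConnected (M : Matroid β) : Prop :=
  ∀ e ∈ M.E, ∀ f ∈ M.E, e ≠ f → ∃ C, M.IsCircuit C ∧ e ∈ C ∧ f ∈ C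

/-- `M` is connected, and `M / F` is connected for every flat `F`. -/
def IsUnbreakable (M : Matroid β) : Prop :=
  M.IsConnected ∧ ∀ F, M.IsFlat F → (M ／ F).IsConnected

/-- `(X, E - X)` is a `k`-separation: both sides have at least `k` elements, and
`r(X) + r(E - X) - r(M) < k` (for a matroid of finite rank). -/
def IsKSeparation (M : Matroid β) (k : ℕ) (X : Set β) : Prop :=
  X ⊆ M.E ∧ k ≤ X.encard ∧ k ≤ (M.E \ X).encard ∧ M.eRk X + M.eRk (M.E \ X) < M.eRank + k

/-- `M` is `n`-connected: it has no `k`-separation with `1 ≤ k < n`. -/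
def IsNConnected (M : Matroid β) (n : ℕ) : Prop :=
  ∀ k, 1 ≤ k → k < n → ∀ X, ¬ M.IsKSeparation k X

end Matroid

/-!
Let `v 0, …, v n` be the cyclic order of the vertices. The edges of `G` are loops and members of
`n + 1` parallel classes, class `i` joining `v i` to `v (i + 1)`. The only cycles of `G` are the
loops, the pairs of parallel edges, and the transversals, which take one edge from each class
(`Graph.IsThickCycle.isCycle_cases`). Hence a Hamiltonian path, that is, a transversal without one
of its members, is independent in the lift matroid, and it remains so after adding one more edge
unless that gives a balanced transversal (`indep_insert`). If `M` is simple, then all cycles of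
length at most two are unbalanced, and a path together with an edge parallel to one of its members
is a base; so `M` has rank `n + 1` (`eRank_eq`).

*Connectivity.* A circuit with at most two elements gives a `1`- or `2`-separation. If two classes
are singletons `{e}` and `{f}`, then every cycle through `e` is a transversal and contains `f`, so
`E - {e, f}` is not spanning and `{e, f}` is one side of a `2`-separation. Conversely, let `(X, Y)` be
a partition of the edges, where `X` and `Y` miss `p` and `q` classes. If `p, q ≥ 2`, then each side
contains a pair of parallel edges, because it contains all edges of two classes, and the ranks of
`X` and `Y` are at least `n + 2 - p` and `n + 2 - q`, where `p + q ≤ n + 1`. If `p ≤ 1`, then either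
`X` contains a cycle of length at most two and is spanning, or `q ≤ 1` too and both sides have rank
at least `n` (`isNConnected_three`).

*Unbreakability.* Two elements `e` and `f` outside a flat `F` lie in a common circuit of `M ／ F` as
soon as some `H ⊇ F` does not span `e` but becomes spanning when `f` is added
(`Matroid.exists_isCircuit_contract`). If `F` misses at most one class, then `H = F` has this
property. Otherwise, if `F` misses the classes of both `e` and `f`, then `H` consists of the edges
outside two missed classes (`exists_isCircuit_contract_of_missed`). If `F` does not miss the class
of `f`, or `f` is a loop, then `F` contains no cycle of length at most two, since such a cycle would
put `f` into the flat `F`; so `F` extends to a Hamiltonian path, and `H` is such a path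
(`exists_isCircuit_contract_of_hit`). The interesting case is that `e` is alone in its class and
forms a balanced cycle with the path. Then replacing an edge of the path by a parallel one gives an
unbalanced cycle through `e`, by the theta property.
-/

open Set
open scoped Matroid

lemma Set.encard_pair_le_two (a b : β) : ({a, b} : Set β).encard ≤ 2 :=
  (encard_insert_le _ _).trans (by rw [encard_singleton]; rfl)

namespace Graph

variable {α β : Type*} {G : Graph α β} {𝓑 : Set (Set β)} {n : ℕ} {v : Fin (n + 1) → α}

/-! ### Paths, cycles and thetas -/

lemma endSet_singleton {e : β} {x y : α} (h : G.IsLink e x y) : G.endSet {e} = {x, y} := by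
  ext z
  simp only [endSet, mem_singleton_iff, exists_eq_left, mem_ofPred_eq, mem_insert_iff]
  refine ⟨fun hz ↦ hz.eq_or_eq_of_isLink h, ?_⟩
  rintro (rfl | rfl)
  exacts [h.inc_left, h.inc_right]

lemma endSet_pair {a b : β} {x y : α} (ha : G.IsLink a x y) (hb : G.IsLink b x y) :
    G.endSet {a, b} = {x, y} := by
  have h : G.endSet {a, b} = G.endSet {a} ∪ G.endSet {b} := by
    ext z; simp [endSet]
  rw [h, endSet_singleton ha, endSet_singleton hb, union_self]

lemma IsLoopAt.isCycle {e : β} {x : α} (he : G.IsLoopAt e x) : G.IsCycle {e} :=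
  ⟨0, fun _ ↦ x, fun _ ↦ e, fun i j _ ↦ Subsingleton.elim (α := Fin 1) i j,
    fun i j _ ↦ Subsingleton.elim (α := Fin 1) i j, fun _ ↦ he, by simp⟩

lemma IsCycle.nonempty {C : Set β} (h : G.IsCycle C) : C.Nonempty := by
  obtain ⟨n, v, e, -, -, -, rfl⟩ := h
  exact ⟨e 0, 0, rfl⟩

lemma IsCycle.subset_edgeSet {C : Set β} (h : G.IsCycle C) : C ⊆ G.edgeSet := by
  obtain ⟨n, v, e, -, -, h, rfl⟩ := h
  rintro _ ⟨i, rfl⟩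
  exact (h i).edge_mem

lemma IsCycle.endSet_nonempty {C : Set β} (h : G.IsCycle C) : (G.endSet C).Nonempty := by
  obtain ⟨n, v, e, -, -, h, rfl⟩ := h
  exact ⟨v 0, e 0, ⟨0, rfl⟩, (h 0).inc_left⟩

/-- A path with distinct ends, with its vertices and edges indexed by natural numbers. -/
lemma IsPathBetween.exists_nat {x y : α} {P : Set β} (h : G.IsPathBetween x y P) (hxy : x ≠ y) :
    ∃ (n : ℕ) (v : ℕ → α) (e : ℕ → β), 0 < n ∧ InjOn v (Iic n) ∧ v 0 = x ∧ v n = y ∧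
      (∀ i < n, G.IsLink (e i) (v i) (v (i + 1))) ∧ InjOn e (Iio n) ∧ P = e '' Iio n := by
  obtain ⟨n, v, e, hv, rfl, rfl, hl, rfl⟩ := h
  have hinj : Function.Injective e := by
    intro i j hij
    have h := (hl i).eq_and_eq_or_eq_and_eq (hij ▸ hl j)
    simp only [hv.eq_iff] at h
    grind
  obtain rfl | hn := n.eq_zero_or_pos
  · exact absurd rfl hxy
  refine ⟨n, fun i ↦ if h : i < n + 1 then v ⟨i, h⟩ else v 0,
    fun i ↦ if h : i < n then e ⟨i, h⟩ else e ⟨0, hn⟩, hn, ?_, ?_, ?_, ?_, ?_, ?_⟩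
  · intro i hi j hj hij
    simp only [mem_Iic] at hi hj
    simpa [Nat.lt_succ_of_le hi, Nat.lt_succ_of_le hj, hv.eq_iff] using hij
  · simp
  · simp [Fin.last]
  · intro i hi
    have := hl ⟨i, hi⟩
    simpa [hi, hi.trans (Nat.lt_succ_self n)] using this
  · intro i hi j hj hij
    simp only [mem_Iio] at hi hj
    simpa [hi, hj, hinj.eq_iff] using hij
  · ext f
    simp only [mem_range, mem_image, mem_Iio]
    constructor
    · rintro ⟨i, rfl⟩
      exact ⟨i, i.2, by simp⟩
    · rintro ⟨i, hi, rfl⟩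
      exact ⟨⟨i, hi⟩, by simp [hi]⟩


lemma isCycle_image_of_nat {N : ℕ} {u : ℕ → α} {g : ℕ → β} (hu : InjOn u (Iic N))
    (hg : InjOn g (Iic N)) (hl : ∀ i < N, G.IsLink (g i) (u i) (u (i + 1)))
    (hN : G.IsLink (g N) (u N) (u 0)) : G.IsCycle (g '' Iic N) := by
  refine ⟨N, fun i ↦ u i, fun i ↦ g i, fun i j hij ↦ ?_, fun i j hij ↦ ?_, fun i ↦ ?_, ?_⟩
  · exact Fin.ext (hu (Nat.lt_succ_iff.1 i.2) (Nat.lt_succ_iff.1 j.2) hij)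
  · exact Fin.ext (hg (Nat.lt_succ_iff.1 i.2) (Nat.lt_succ_iff.1 j.2) hij)
  · obtain ⟨i, rfl⟩ | rfl := i.eq_castSucc_or_eq_last
    · have := hl i i.2
      simpa [Fin.val_add_one_of_lt' (show (i.castSucc : ℕ) + 1 < N + 1 by simp)] using this
    · simpa using hN
  · ext f
    simp only [mem_image, mem_Iic, mem_range]
    constructor
    · rintro ⟨i, hi, rfl⟩
      exact ⟨⟨i, Nat.lt_succ_of_le hi⟩, rfl⟩
    · rintro ⟨i, rfl⟩
      exact ⟨i, Nat.lt_succ_iff.1 i.2, rfl⟩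

/-- Two internally disjoint paths between the same two vertices form a cycle: run along the first
path and return along the second. -/
lemma IsPathBetween.isCycle_union {x y : α} {P Q : Set β} (hxy : x ≠ y)
    (hP : G.IsPathBetween x y P) (hQ : G.IsPathBetween x y Q) (hPQ : Disjoint P Q)
    (hV : G.endSet P ∩ G.endSet Q = {x, y}) : G.IsCycle (P ∪ Q) := by
  obtain ⟨n, v, e, hn, hv, rfl, rfl, hvl, he, rfl⟩ := hP.exists_nat hxy
  obtain ⟨m, w, f, hm, hw, hw0, hwm, hwl, hf, rfl⟩ := hQ.exists_nat hxy
  have hmeet : ∀ i ≤ n, ∀ j ≤ m, v i = w j → j = 0 ∨ j = m := by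
    intro i hi j hj hij
    have h1 : v i ∈ G.endSet (e '' Iio n) := by
      obtain rfl | hi := hi.eq_or_lt
      · refine ⟨e (i - 1), ⟨i - 1, by simp; omega, rfl⟩, ?_⟩
        have := (hvl (i - 1) (by omega)).inc_right
        rwa [Nat.sub_add_cancel hn] at this
      · exact ⟨e i, ⟨i, hi, rfl⟩, (hvl i hi).inc_left⟩
    have h2 : v i ∈ G.endSet (f '' Iio m) := by
      rw [hij]
      obtain rfl | hj := hj.eq_or_lt
      · refine ⟨f (j - 1), ⟨j - 1, by simp; omega, rfl⟩, ?_⟩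
        have := (hwl (j - 1) (by omega)).inc_right
        rwa [Nat.sub_add_cancel hm] at this
      · exact ⟨f j, ⟨j, hj, rfl⟩, (hwl j hj).inc_left⟩
    have h3 : v i ∈ ({v 0, v n} : Set α) := hV ▸ ⟨h1, h2⟩
    rw [hij, ← hw0, ← hwm] at h3
    exact h3.imp (fun h ↦ hw hj (by simp) h) (fun h ↦ hw hj (by simp) h)
  have hdis : ∀ i < n, ∀ j < m, e i ≠ f j := fun i hi j hj hij ↦
    hPQ.le_bot ⟨⟨i, hi, rfl⟩, hij ▸ ⟨j, hj, rfl⟩⟩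
  have hset : e '' Iio n ∪ f '' Iio m =
      (fun k ↦ if k < n then e k else f (n + m - 1 - k)) '' Iic (n + m - 1) := by
    ext a
    simp only [mem_union, mem_image, mem_Iio, mem_Iic]
    constructor
    · rintro (⟨i, hi, rfl⟩ | ⟨i, hi, rfl⟩)
      · exact ⟨i, by omega, by simp [hi]⟩
      · refine ⟨n + m - 1 - i, by omega, ?_⟩
        rw [if_neg (by omega)]
        congr 1
        omega
    · rintro ⟨i, hi, rfl⟩
      split_ifs with h
      · exact .inl ⟨i, h, rfl⟩
      · exact .inr ⟨_, by omega, rfl⟩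
  rw [hset]
  have hw_end : ∀ k, ¬ k < n + 1 → k ≤ n + m - 1 → n + m - k ≠ 0 ∧ n + m - k ≠ m := by omega
  refine isCycle_image_of_nat (u := fun k ↦ if k < n + 1 then v k else w (n + m - k)) ?_ ?_ ?_ ?_
  · intro i hi j hj hij
    simp only [mem_Iic] at hi hj
    dsimp only at hij
    split_ifs at hij with h1 h2 h2
    · exact hv (by simp; omega) (by simp; omega) hij
    · have := hmeet i (by omega) _ (by omega) hij
      have := hw_end j h2 hj
      omega
    · have := hmeet j (by omega) _ (by omega) hij.symm
      have := hw_end i h1 hi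
      omega
    · have := hw (by simp; omega) (by simp; omega) hij
      omega
  · intro i hi j hj hij
    simp only [mem_Iic] at hi hj
    dsimp only at hij
    split_ifs at hij with h1 h2 h2
    · exact he h1 h2 hij
    · exact absurd hij (hdis _ h1 _ (by omega))
    · exact absurd hij.symm (hdis _ h2 _ (by omega))
    · have := hf (by simp; omega) (by simp; omega) hij
      omega
  · intro i hi
    by_cases h : i < n
    · simpa [h, h.trans (Nat.lt_succ_self n)] using hvl i h
    rw [if_neg h, if_neg (by omega : ¬ i + 1 < n + 1)]
    have hl := hwl (n + m - 1 - i) (by omega)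
    rw [show n + m - 1 - i + 1 = n + m - i by omega] at hl
    rw [show n + m - (i + 1) = n + m - 1 - i by omega]
    split_ifs with h'
    · obtain rfl : i = n := by omega
      rw [Nat.add_sub_cancel_left, hwm] at hl
      exact hl.symm
    · exact hl.symm
  · have hl := hwl 0 hm
    rw [if_neg (by omega), if_pos (by omega : 0 < n + 1), Nat.sub_self, ← hw0]
    split_ifs with h
    · obtain rfl : m = 1 := by omega
      simpa [hwm] using hl.symm
    · rw [show n + m - (n + m - 1) = 0 + 1 by omega]
      exact hl.symm

lemma IsPathBetween.nonempty {x y : α} {P : Set β} (h : G.IsPathBetween x y P) (hxy : x ≠ y) :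
    P.Nonempty := by
  obtain ⟨n, v, e, hn, -, -, -, -, -, rfl⟩ := h.exists_nat hxy
  exact ⟨e 0, 0, hn, rfl⟩

lemma IsTheta.rotate {P Q R : Set β} (h : G.IsTheta P Q R) : G.IsTheta Q R P := by
  obtain ⟨x, y, hxy, hP, hQ, hR, h1, h2, h3, h4, h5, h6⟩ := h
  exact ⟨x, y, hxy, hQ, hR, hP, h2, h3.symm, h1.symm, h5, by rw [inter_comm, h6],
    by rw [inter_comm, h4]⟩

lemma IsTheta.swap {P Q R : Set β} (h : G.IsTheta P Q R) : G.IsTheta Q P R := by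
  obtain ⟨x, y, hxy, hP, hQ, hR, h1, h2, h3, h4, h5, h6⟩ := h
  exact ⟨x, y, hxy, hQ, hP, hR, h1.symm, h3, h2, by rw [inter_comm, h4], h6, h5⟩

lemma IsTheta.isCycle {P Q R : Set β} (h : G.IsTheta P Q R) : G.IsCycle (P ∪ Q) := by
  obtain ⟨x, y, hxy, hP, hQ, hR, h1, h2, h3, h4, h5, h6⟩ := h
  exact hP.isCycle_union hxy hQ h1 h4

/-- Every element of a circuit of the lift matroid lies in a cycle inside the circuit. -/
lemma IsLiftCircuit.exists_isCycle (hB : G.IsBiased 𝓑) {K : Set β} (hK : G.IsLiftCircuit 𝓑 K)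
    {e : β} (he : e ∈ K) : ∃ C ⊆ K, G.IsCycle C ∧ e ∈ C := by
  cases hK with
  | balanced _ hC => exact ⟨K, Subset.rfl, hB.isCycle K hC, he⟩
  | theta P Q R h =>
    obtain (heP | heQ) | heR := he
    · exact ⟨P ∪ Q, subset_union_left, h.isCycle, .inl heP⟩
    · exact ⟨P ∪ Q, subset_union_left, h.isCycle, .inr heQ⟩
    · exact ⟨Q ∪ R, by grind, h.rotate.isCycle, .inr heR⟩
  | tightHandcuff C D hC hD =>
    obtain he | he := he
    exacts [⟨C, subset_union_left, hC.1, he⟩, ⟨D, subset_union_right, hD.1, he⟩]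
  | disjointCycles C D hC hD =>
    obtain he | he := he
    exacts [⟨C, subset_union_left, hC.1, he⟩, ⟨D, subset_union_right, hD.1, he⟩]

/-- A set of edges that contains at most one cycle, and no balanced one, contains no circuit of the
lift matroid. -/
lemma not_isLiftCircuit_of_unique {S K : Set β} (hbal : ∀ C ⊆ S, C ∉ 𝓑)
    (huniq : ∀ C ⊆ S, ∀ D ⊆ S, G.IsCycle C → G.IsCycle D → C = D) (hKS : K ⊆ S) :
    ¬ G.IsLiftCircuit 𝓑 K := by
  intro hK
  cases hK with
  | balanced _ hC => exact hbal K hKS hC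
  | theta P Q R h =>
    have heq := huniq (P ∪ Q) (by grind) (Q ∪ R) (by grind) h.isCycle h.rotate.isCycle
    obtain ⟨x, y, hxy, -, -, hR, -, h2, h3, -⟩ := h
    obtain ⟨e, he⟩ := hR.nonempty hxy
    have he' : e ∈ P ∪ Q := heq ▸ .inr he
    exact he'.elim (fun h ↦ h3.le_bot ⟨h, he⟩) (fun h ↦ h2.le_bot ⟨h, he⟩)
  | tightHandcuff C D hC hD hCD =>
    obtain rfl := huniq C (by grind) D (by grind) hC.1 hD.1
    exact hC.1.nonempty.ne_empty (disjoint_self.1 hCD)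
  | disjointCycles C D hC hD hCD =>
    obtain rfl := huniq C (by grind) D (by grind) hC.1 hD.1
    exact hC.1.endSet_nonempty.ne_empty (disjoint_self.1 hCD)

/-! ### Cycles with parallel classes -/

/-- The edges between the consecutive vertices `v i` and `v (i + 1)`, indices modulo `n + 1`. -/
def edgeClass (G : Graph α β) (v : Fin (n + 1) → α) (i : Fin (n + 1)) : Set β :=
  {e | G.IsLink e (v i) (v (i + 1))}

/-- Up to loops, `G` is a cycle through the distinct vertices `v 0, …, v n`, with each edge replaced
by a nonempty class of parallel edges. There are at least three vertices, so that edges in different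
classes are not parallel. -/
structure IsThickCycle (G : Graph α β) (v : Fin (n + 1) → α) : Prop where
  two_le : 2 ≤ n
  inj : Function.Injective v
  nonempty : ∀ i, (G.edgeClass v i).Nonempty
  cover : ∀ e ∈ G.edgeSet, (∃ x, G.IsLoopAt e x) ∨ ∃ i, e ∈ G.edgeClass v i

/-- `t` selects one edge from each parallel class. -/
def IsTransversal (G : Graph α β) (v : Fin (n + 1) → α) (t : Fin (n + 1) → β) : Prop :=
  ∀ i, t i ∈ G.edgeClass v i

lemma fin_add_one_ne (hn : 2 ≤ n) (i : Fin (n + 1)) : i + 1 ≠ i := by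
  intro h
  have h1 : (1 : Fin (n + 1)) = 0 := by simpa using h
  have := congrArg Fin.val h1
  simp [Nat.mod_eq_of_lt (show 1 < n + 1 by omega)] at this

lemma fin_add_two_ne (hn : 2 ≤ n) (i : Fin (n + 1)) : i + 1 + 1 ≠ i := by
  intro h
  have h1 : (1 : Fin (n + 1)) + 1 = 0 := by simpa [add_assoc] using h
  have := congrArg Fin.val h1
  rw [Fin.val_add] at this
  simp [Nat.mod_eq_of_lt (show 1 < n + 1 by omega), Nat.mod_eq_of_lt (show 2 < n + 1 by omega)]
    at this

lemma fin_eq_univ_of_add_one_mem {S : Set (Fin (n + 1))} (hne : S.Nonempty)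
    (hS : ∀ i ∈ S, i + 1 ∈ S) : S = univ := by
  obtain ⟨k, hk⟩ := hne
  have h : ∀ m : ℕ, k + m • 1 ∈ S := by
    intro m
    induction m with
    | zero => simpa using hk
    | succ m ih =>
      rw [succ_nsmul, ← add_assoc]
      exact hS _ ih
  refine eq_univ_of_forall fun i ↦ ?_
  have := h (i - k).val
  have h1 : ∀ j : Fin (n + 1), j.val • (1 : Fin (n + 1)) = j := by
    intro j
    open Fin.CommRing in
    rw [nsmul_one, Fin.cast_val_eq_self]
  rwa [h1, add_sub_cancel] at this

namespace IsThickCycle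

lemma add_one_ne (h : G.IsThickCycle v) (i : Fin (n + 1)) : v i ≠ v (i + 1) :=
  fun h' ↦ fin_add_one_ne h.two_le i (h.inj h').symm

lemma not_isLoopAt (h : G.IsThickCycle v) {e : β} {i : Fin (n + 1)} (he : e ∈ G.edgeClass v i)
    {x : α} : ¬ G.IsLoopAt e x := by
  intro hx
  have h1 := hx.eq_of_inc he.inc_left
  have h2 := hx.eq_of_inc he.inc_right
  exact h.add_one_ne i (h1.symm.trans h2)

lemma eq_of_mem (h : G.IsThickCycle v) {e : β} {i j : Fin (n + 1)} (hi : e ∈ G.edgeClass v i)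
    (hj : e ∈ G.edgeClass v j) : i = j := by
  obtain h1 | h1 := IsLink.eq_and_eq_or_eq_and_eq hi hj
  · exact h.inj h1.1
  · have h2 := h.inj h1.1
    have h3 := h.inj h1.2
    rw [h2] at h3
    exact absurd h3 (fin_add_two_ne h.two_le j)

lemma endSet_inter_subsingleton (h : G.IsThickCycle v) {i j : Fin (n + 1)} (hij : i ≠ j) :
    (({v i, v (i + 1)} : Set α) ∩ {v j, v (j + 1)}).Subsingleton := by
  have := fin_add_two_ne h.two_le i
  have := fin_add_two_ne h.two_le j
  have := fin_add_one_ne h.two_le i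
  have := fin_add_one_ne h.two_le j
  have h1 : i + 1 = j + 1 → i = j := fun h ↦ add_right_cancel h
  rintro x ⟨hx1, hx2⟩ y ⟨hy1, hy2⟩
  simp only [mem_insert_iff, mem_singleton_iff] at hx1 hx2 hy1 hy2
  obtain rfl | rfl := hx1 <;> obtain rfl | rfl := hy1 <;> simp only [h.inj.eq_iff] at * <;> grind

lemma injective (h : G.IsThickCycle v) {t : Fin (n + 1) → β} (ht : G.IsTransversal v t) :
    Function.Injective t := fun i j hij ↦ h.eq_of_mem (ht i) (hij ▸ ht j)

lemma exists_transversal (h : G.IsThickCycle v) : ∃ t, G.IsTransversal v t :=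
  ⟨fun i ↦ (h.nonempty i).some, fun i ↦ (h.nonempty i).some_mem⟩

lemma isCycle_pair (h : G.IsThickCycle v) {a b : β} {i : Fin (n + 1)} (ha : a ∈ G.edgeClass v i)
    (hb : b ∈ G.edgeClass v i) (hab : a ≠ b) : G.IsCycle {a, b} := by
  have hne := h.add_one_ne i
  refine ⟨1, ![v i, v (i + 1)], ![a, b], ?_, ?_, ?_, ?_⟩
  · intro x y
    fin_cases x <;> fin_cases y <;> simp [hne, hne.symm]
  · intro x y
    fin_cases x <;> fin_cases y <;> simp [hab, hab.symm]
  · intro x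
    fin_cases x
    · exact ha
    · exact hb.symm
  · simp [Matrix.range_cons, pair_comm]

/-- The cycles of a thick cycle are its loops, its pairs of parallel edges, and its transversals. A
cycle of length at least three cannot use a parallel class twice, and at each of its vertices it
passes on to the neighbouring class. -/
lemma isCycle_cases (h : G.IsThickCycle v) {C : Set β} (hC : G.IsCycle C) :
    (∃ e x, G.IsLoopAt e x ∧ C = {e}) ∨
    (∃ i a b, a ∈ G.edgeClass v i ∧ b ∈ G.edgeClass v i ∧ a ≠ b ∧ C = {a, b}) ∨
    ∃ t, G.IsTransversal v t ∧ C = range t := by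
  have hCE := hC.subset_edgeSet
  obtain ⟨m, w, e, hw, he, hl, rfl⟩ := hC
  obtain rfl | hm := m.eq_zero_or_pos
  · refine .inl ⟨e 0, w 0, by simpa using hl 0, ?_⟩
    ext; simp [eq_comm]
  have hcls : ∀ i, i + 1 ≠ i → ∃ k, e i ∈ G.edgeClass v k := by
    intro i hi
    refine (h.cover (e i) (hCE ⟨i, rfl⟩)).resolve_left ?_
    rintro ⟨x, hx⟩
    have h1 := hx.eq_of_inc (hl i).inc_left
    have h2 := hx.eq_of_inc (hl i).inc_right
    exact hi (hw (h2.symm.trans h1))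
  obtain rfl | hm2 : m = 1 ∨ 2 ≤ m := by omega
  · obtain ⟨k, hk⟩ := hcls 0 (by decide)
    have h0 := hl 0
    have h1 := (hl 1).symm
    refine .inr (.inl ⟨k, e 0, e 1, hk, ?_, he.ne (by decide), ?_⟩)
    · have hk' : G.IsLink (e 0) _ _ := hk
      rw [h0.isLink_iff] at hk'
      exact h1.isLink_iff.2 hk'
    · ext; simp [Fin.exists_fin_two, eq_comm]
  choose f hf using fun i ↦ hcls i (fin_add_one_ne hm2 i)
  have hfinj : Function.Injective f := by
    intro i j hij
    have hj := hf j
    rw [← hij] at hj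
    have h2 : G.IsLink (e j) (w i) (w (i + 1)) := by
      have hi' : G.IsLink (e i) _ _ := hf i
      have hj' : G.IsLink (e j) _ _ := hj
      rw [(hl i).isLink_iff] at hi'
      obtain ⟨h3, h4⟩ | ⟨h3, h4⟩ := hi'
      · rwa [h3, h4]
      · rw [h3, h4]; exact hj'.symm
    obtain h3 | h3 := h2.eq_and_eq_or_eq_and_eq (hl j)
    · exact hw h3.1
    · have h4 := hw h3.1
      have h5 := hw h3.2
      rw [h4] at h5
      exact absurd h5 (fin_add_two_ne hm2 j)
  have hnext : ∀ i j k, f i = k → i ≠ j → G.Inc (e j) (v (k + 1)) → f j = k + 1 := by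
    rintro i j k rfl hij hinc
    obtain h1 | h1 := hinc.eq_or_eq_of_isLink (hf j)
    · exact (h.inj h1).symm
    · exact absurd (hfinj (add_right_cancel (h.inj h1))) hij
  have huniv : range f = univ := by
    refine fin_eq_univ_of_add_one_mem ⟨f 0, 0, rfl⟩ ?_
    rintro _ ⟨i, rfl⟩
    have hinc : G.Inc (e i) (v (f i + 1)) := (hf i).inc_right
    obtain h1 | h1 := hinc.eq_or_eq_of_isLink (hl i)
    · refine ⟨i - 1, hnext i (i - 1) _ rfl ?_ ?_⟩
      · intro h2
        have := fin_add_one_ne hm2 (i - 1)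
        rw [sub_add_cancel] at this
        exact this h2
      · have := (hl (i - 1)).inc_right
        rwa [sub_add_cancel, ← h1] at this
    · exact ⟨i + 1, hnext i (i + 1) _ rfl (fin_add_one_ne hm2 i).symm (h1 ▸ (hl (i + 1)).inc_left)⟩
  have hsurj : Function.Surjective f := range_eq_univ.1 huniv
  refine .inr (.inr ⟨fun k ↦ e (hsurj k).choose, fun k ↦ ?_, ?_⟩)
  · have := hf (hsurj k).choose
    rwa [(hsurj k).choose_spec] at this
  · ext a
    constructor
    · rintro ⟨i, rfl⟩
      exact ⟨f i, congrArg e (hfinj (hsurj (f i)).choose_spec)⟩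
    · rintro ⟨k, rfl⟩
      exact ⟨_, rfl⟩

lemma isPathBetween_singleton {e : β} {x y : α} (he : G.IsLink e x y) (hxy : x ≠ y) :
    G.IsPathBetween x y {e} := by
  refine ⟨1, ![x, y], ![e], ?_, rfl, rfl, ?_, ?_⟩
  · intro i j
    fin_cases i <;> fin_cases j <;> simp [hxy, hxy.symm]
  · intro i
    fin_cases i
    exact he
  · simp [Matrix.range_cons]

lemma isTheta_parallel (h : G.IsThickCycle v) {a b c : β} {i : Fin (n + 1)}
    (ha : a ∈ G.edgeClass v i) (hb : b ∈ G.edgeClass v i) (hc : c ∈ G.edgeClass v i)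
    (hab : a ≠ b) (hbc : b ≠ c) (hac : a ≠ c) : G.IsTheta {a} {b} {c} := by
  have hne := h.add_one_ne i
  refine ⟨v i, v (i + 1), hne, isPathBetween_singleton ha hne, isPathBetween_singleton hb hne,
    isPathBetween_singleton hc hne, by simpa, by simpa, by simpa, ?_⟩
  simp [endSet_singleton ha, endSet_singleton hb, endSet_singleton hc]

/-- A transversal and a further edge `s` parallel to its member `t k` form a theta. -/
lemma isTheta_transversal (h : G.IsThickCycle v) {t : Fin (n + 1) → β} (ht : G.IsTransversal v t)
    {k : Fin (n + 1)} {s : β} (hs : s ∈ G.edgeClass v k) (hsk : s ≠ t k) :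
    G.IsTheta {t k} {s} (range t \ {t k}) := by
  have hne := h.add_one_ne k
  have htk : G.endSet {t k} = {v (k + 1), v k} := endSet_singleton (ht k).symm
  have hsE : G.endSet {s} = {v (k + 1), v k} := endSet_singleton hs.symm
  have hR : {v (k + 1), v k} ⊆ G.endSet (range t \ {t k}) := by
    rintro x (rfl | rfl)
    · refine ⟨t (k + 1), ⟨⟨_, rfl⟩, fun h' ↦ ?_⟩, (ht (k + 1)).inc_left⟩
      exact fin_add_one_ne h.two_le k (h.injective ht h')
    · refine ⟨t (k - 1), ⟨⟨_, rfl⟩, fun h' ↦ ?_⟩, ?_⟩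
      · have := fin_add_one_ne h.two_le (k - 1)
        rw [sub_add_cancel] at this
        exact this (h.injective ht h').symm
      · have := (ht (k - 1)).inc_right
        rwa [sub_add_cancel] at this
  refine ⟨v (k + 1), v k, hne.symm, isPathBetween_singleton (ht k).symm hne.symm,
    isPathBetween_singleton hs.symm hne.symm, ?_, by simpa using hsk.symm, ?_, by simp, ?_, ?_, ?_⟩
  · refine ⟨n, fun j ↦ v (k + 1 + j), fun j ↦ t (k + 1 + j.castSucc), ?_, by simp, ?_, ?_, ?_⟩
    · intro i j hij
      exact add_left_cancel (h.inj hij)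
    · simp [add_assoc, add_comm (1 : Fin (n + 1))]
    · intro i
      have h1 : k + 1 + i.succ = k + 1 + i.castSucc + 1 := by
        rw [add_assoc _ i.castSucc, Fin.coeSucc_eq_succ]
      dsimp only
      rw [h1]
      exact ht (k + 1 + i.castSucc)
    · ext a
      simp only [mem_sdiff, mem_range, mem_singleton_iff]
      constructor
      · rintro ⟨⟨i, rfl⟩, hi⟩
        have hik : i - (k + 1) ≠ Fin.last n := by
          intro h'
          apply hi
          rw [sub_eq_iff_eq_add.1 h', ← add_assoc, add_comm _ k, add_assoc, Fin.last_add_one,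
            add_zero]
        obtain ⟨j, hj⟩ := Fin.exists_castSucc_eq.2 hik
        exact ⟨j, by rw [hj, add_sub_cancel]⟩
      · rintro ⟨j, rfl⟩
        refine ⟨⟨_, rfl⟩, fun h' ↦ ?_⟩
        have h1 := h.injective ht h'
        rw [add_assoc, add_eq_left] at h1
        have h2 : j.succ = 0 := by rwa [← Fin.coeSucc_eq_succ, add_comm j.castSucc]
        exact Fin.succ_ne_zero _ h2
  · rw [disjoint_singleton_left]
    rintro ⟨⟨i, rfl⟩, hi⟩
    exact hi (congrArg t (h.eq_of_mem (ht i) hs))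
  · rw [htk, hsE, inter_self]
  · rw [hsE]; exact inter_eq_left.2 hR
  · rw [htk]; exact inter_eq_left.2 hR

end IsThickCycle

/-- A graph whose simplification is a cycle is a thick cycle. -/
lemma SimplificationIsCycle.exists_isThickCycle (hG : G.SimplificationIsCycle)
    (hV : 6 < G.vertexSet.encard) :
    ∃ (n : ℕ) (v : Fin (n + 1) → α), 6 ≤ n ∧ G.IsThickCycle v := by
  obtain ⟨H, ⟨hHG, -, hadj⟩, ⟨n, v, e, hv, he, hl, hE⟩, hVE⟩ := hG
  have hrange : G.vertexSet ⊆ range v := by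
    rw [← hHG.vertexSet_eq, ← hVE, hE]
    rintro x ⟨_, ⟨i, rfl⟩, hx⟩
    obtain rfl | rfl := hx.eq_or_eq_of_isLink (hl i)
    exacts [⟨_, rfl⟩, ⟨_, rfl⟩]
  have hn : 6 ≤ n := by
    have h1 := hV.trans_le (encard_le_encard hrange)
    rw [← image_univ, hv.encard_image, encard_univ, ENat.card_eq_coe_fintype_card,
      Fintype.card_fin] at h1
    have : 6 < n + 1 := by exact_mod_cast h1
    omega
  refine ⟨n, v, hn, by omega, hv, fun i ↦ ⟨e i, hHG.le.isLink_mono (hl i)⟩, fun g hg ↦ ?_⟩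
  obtain ⟨x, y, hxy⟩ := exists_isLink_of_mem_edgeSet hg
  obtain rfl | hne := eq_or_ne x y
  · exact .inl ⟨x, hxy⟩
  obtain ⟨g', hg'⟩ := hadj x y hne ⟨g, hxy⟩
  obtain ⟨i, rfl⟩ : g' ∈ range e := hE ▸ hg'.edge_mem
  exact .inr ⟨i, hxy.isLink_iff.2 (hg'.isLink_iff.1 (hl i))⟩

variable {M : Matroid β}

/-! ### Circuits and independent sets of the lift matroid -/

namespace IsLiftMatroid

lemma indep_of_unique (hM : G.IsLiftMatroid 𝓑 M) {S : Set β} (hS : S ⊆ G.edgeSet)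
    (hbal : ∀ C ⊆ S, C ∉ 𝓑)
    (huniq : ∀ C ⊆ S, ∀ D ⊆ S, G.IsCycle C → G.IsCycle D → C = D) : M.Indep S := by
  rw [Matroid.indep_iff_forall_subset_not_isCircuit (hS.trans_eq hM.1.symm)]
  intro C hC hCM
  exact not_isLiftCircuit_of_unique hbal huniq hC ((hM.2 C).1 hCM)

lemma isUnbalancedCycle_of_encard_le_two (hM : G.IsLiftMatroid 𝓑 M) (hS : M.IsSimple)
    {D : Set β} (hD : G.IsCycle D) (hD2 : D.encard ≤ 2) : G.IsUnbalancedCycle 𝓑 D :=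
  ⟨hD, fun h ↦ (hS D ((hM.2 D).2 (.balanced D h))).not_ge hD2⟩

lemma isCircuit_union (hM : G.IsLiftMatroid 𝓑 M) {C D : Set β} (hC : G.IsUnbalancedCycle 𝓑 C)
    (hD : G.IsUnbalancedCycle 𝓑 D) (hCD : Disjoint C D)
    (h : (G.endSet C ∩ G.endSet D).Subsingleton) : M.IsCircuit (C ∪ D) := by
  rw [hM.2]
  obtain h | ⟨x, hx⟩ := h.eq_empty_or_singleton
  · exact .disjointCycles C D hC hD (disjoint_iff_inter_eq_empty.2 h)
  · exact .tightHandcuff C D hC hD hCD x hx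

/-- An unbalanced cycle of length at most two spans all loops. -/
lemma loop_mem_closure (hM : G.IsLiftMatroid 𝓑 M) (hS : M.IsSimple)
    {D X : Set β} (hD : G.IsCycle D) (hD2 : D.encard ≤ 2) (hDX : D ⊆ X) {e : β} {x : α}
    (he : G.IsLoopAt e x) : e ∈ M.closure X := by
  refine M.closure_subset_closure hDX ?_
  by_cases heD : e ∈ D
  · exact M.mem_closure_of_mem heD (hD.subset_edgeSet.trans_eq hM.1.symm)
  rw [Matroid.mem_closure_iff_exists_isCircuit heD]
  refine ⟨_, Subset.rfl, ?_, mem_insert _ _⟩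
  refine hM.isCircuit_union (C := {e})
    (hM.isUnbalancedCycle_of_encard_le_two hS he.isCycle (by simp))
    (hM.isUnbalancedCycle_of_encard_le_two hS hD hD2) (by simpa) ?_
  rw [endSet_singleton he]
  exact subsingleton_singleton.anti (inter_subset_left.trans (pair_eq_singleton x).subset)

end IsLiftMatroid

namespace IsThickCycle

lemma cases_of_encard_le_two (h : G.IsThickCycle v) {D : Set β} (hD : G.IsCycle D)
    (hD2 : D.encard ≤ 2) : (∃ e x, G.IsLoopAt e x ∧ D = {e}) ∨
      ∃ i a b, a ∈ G.edgeClass v i ∧ b ∈ G.edgeClass v i ∧ a ≠ b ∧ D = {a, b} := by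
  obtain h1 | h1 | ⟨t, ht, rfl⟩ := h.isCycle_cases hD
  · exact .inl h1
  · exact .inr h1
  · rw [← image_univ, (h.injective ht).encard_image, encard_univ, ENat.card_eq_coe_fintype_card,
      Fintype.card_fin] at hD2
    have h2 := h.two_le
    have : n + 1 ≤ 2 := by exact_mod_cast hD2
    omega

/-- A set containing an unbalanced cycle of length at most two spans all edges parallel to its
members. -/
lemma parallel_mem_closure (h : G.IsThickCycle v) (hM : G.IsLiftMatroid 𝓑 M) (hS : M.IsSimple)
    {D X : Set β} (hD : G.IsCycle D) (hD2 : D.encard ≤ 2) (hDX : D ⊆ X) (hX : X ⊆ G.edgeSet)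
    {e s : β} {i : Fin (n + 1)} (he : e ∈ G.edgeClass v i) (hs : s ∈ G.edgeClass v i)
    (hsX : s ∈ X) : e ∈ M.closure X := by
  by_cases heX : e ∈ X
  · exact M.mem_closure_of_mem heX (hX.trans_eq hM.1.symm)
  have hes : e ≠ s := by rintro rfl; exact heX hsX
  have hub : ∀ {i a b}, a ∈ G.edgeClass v i → b ∈ G.edgeClass v i → a ≠ b →
      G.IsUnbalancedCycle 𝓑 {a, b} := fun ha hb hab ↦
    hM.isUnbalancedCycle_of_encard_le_two hS (h.isCycle_pair ha hb hab) (encard_pair_le_two _ _)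
  have hkey : Disjoint {e, s} D → (G.endSet {e, s} ∩ G.endSet D).Subsingleton →
      e ∈ M.closure X := by
    intro h1 h2
    rw [Matroid.mem_closure_iff_exists_isCircuit heX]
    exact ⟨_, by grind, hM.isCircuit_union (hub he hs hes)
      (hM.isUnbalancedCycle_of_encard_le_two hS hD hD2) h1 h2, by simp⟩
  obtain ⟨l, x, hl, rfl⟩ | ⟨k, a, b, ha, hb, hab, rfl⟩ := h.cases_of_encard_le_two hD hD2
  · refine hkey ?_ ?_
    · rw [disjoint_singleton_right]
      rintro (rfl | rfl)
      exacts [h.not_isLoopAt he hl, h.not_isLoopAt hs hl]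
    · rw [endSet_singleton hl]
      exact subsingleton_singleton.anti (inter_subset_right.trans (pair_eq_singleton x).subset)
  obtain rfl | hik := eq_or_ne i k
  · rw [Matroid.mem_closure_iff_exists_isCircuit heX]
    have hea : e ≠ a := by grind
    have heb : e ≠ b := by grind
    refine ⟨{e} ∪ {a} ∪ {b}, by grind, (hM.2 _).2 (.theta _ _ _
      (h.isTheta_parallel he ha hb hea hab heb) ?_ ?_ ?_), by simp⟩
    exacts [(hub he ha hea).2, (hub ha hb hab).2, (hub he hb heb).2]
  · refine hkey ?_ ?_
    · rw [disjoint_left]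
      rintro x (rfl | rfl) (rfl | rfl)
      exacts [hik (h.eq_of_mem he ha), hik (h.eq_of_mem he hb), hik (h.eq_of_mem hs ha),
        hik (h.eq_of_mem hs hb)]
    · rw [endSet_pair he hs, endSet_pair ha hb]
      exact h.endSet_inter_subsingleton hik

lemma image_subset_edgeSet {t : Fin (n + 1) → β} (ht : G.IsTransversal v t)
    (J : Set (Fin (n + 1))) : t '' J ⊆ G.edgeSet := by
  rintro _ ⟨i, -, rfl⟩
  exact (ht i).edge_mem

/-- The only cycle in the union of a Hamiltonian path and one more edge `e`: the loop `e`, the pair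
formed by `e` and a parallel edge of the path, or the whole set. -/
lemma isCycle_subset_insert (h : G.IsThickCycle v) {t : Fin (n + 1) → β} (ht : G.IsTransversal v t)
    {j : Fin (n + 1)} {e : β} (he : e ∉ t '' {j}ᶜ) {C : Set β} (hC : G.IsCycle C)
    (hCT : C ⊆ insert e (t '' {j}ᶜ)) :
    ((∃ x, G.IsLoopAt e x) ∧ C = {e}) ∨ ∃ i, e ∈ G.edgeClass v i ∧
      ((i ≠ j ∧ C = {e, t i}) ∨ (i = j ∧ C = insert e (t '' {j}ᶜ))) := by
  have hT : ∀ {i a}, a ∈ G.edgeClass v i → a ∈ C → a ≠ e → i ≠ j ∧ a = t i := by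
    intro i a ha haC hae
    obtain rfl | ⟨k, hk, rfl⟩ := hCT haC
    · exact absurd rfl hae
    · obtain rfl := h.eq_of_mem ha (ht k)
      exact ⟨hk, rfl⟩
  obtain ⟨l, x, hl, rfl⟩ | ⟨k, a, b, ha, hb, hab, rfl⟩ | ⟨t', ht', rfl⟩ := h.isCycle_cases hC
  · left
    obtain rfl | ⟨k, hk, rfl⟩ := hCT rfl
    · exact ⟨⟨x, hl⟩, rfl⟩
    · exact absurd hl (h.not_isLoopAt (ht k))
  · right
    refine ⟨k, ?_⟩
    by_cases hae : a = e
    · subst hae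
      obtain ⟨h1, h2⟩ := hT hb (by simp) hab.symm
      exact ⟨ha, .inl ⟨h1, by rw [h2]⟩⟩
    · obtain ⟨h1, h2⟩ := hT ha (by simp) hae
      by_cases hbe : b = e
      · subst hbe
        exact ⟨hb, .inl ⟨h1, by rw [h2, pair_comm]⟩⟩
      · exact absurd (h2.trans (hT hb (by simp) hbe).2.symm) hab
  · right
    have hj : t' j = e := by
      by_contra h'
      exact (hT (ht' j) ⟨j, rfl⟩ h').1 rfl
    refine ⟨j, hj ▸ ht' j, .inr ⟨rfl, hCT.antisymm ?_⟩⟩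
    refine insert_subset ⟨j, hj⟩ ?_
    rintro _ ⟨i, hi, rfl⟩
    have hne : t' i ≠ e := fun h' ↦ hi (h.injective ht' (h'.trans hj.symm))
    exact ⟨i, (hT (ht' i) ⟨i, rfl⟩ hne).2⟩

/-- A Hamiltonian path together with one more edge is independent, unless it is a balanced
Hamiltonian cycle. -/
lemma indep_insert (h : G.IsThickCycle v) (hB : G.IsBiased 𝓑) (hM : G.IsLiftMatroid 𝓑 M)
    (hS : M.IsSimple) {t : Fin (n + 1) → β} (ht : G.IsTransversal v t) {j : Fin (n + 1)} {e : β}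
    (heE : e ∈ G.edgeSet) (he : e ∉ t '' {j}ᶜ)
    (hbal : e ∈ G.edgeClass v j → insert e (t '' {j}ᶜ) ∉ 𝓑) : M.Indep (insert e (t '' {j}ᶜ)) := by
  refine hM.indep_of_unique (insert_subset heE (image_subset_edgeSet ht _)) ?_ ?_
  · intro C hCT hC
    have hle : ¬ C.encard ≤ 2 := fun h' ↦
      (hM.isUnbalancedCycle_of_encard_le_two hS (hB.isCycle C hC) h').2 hC
    obtain ⟨-, rfl⟩ | ⟨i, hi, ⟨-, rfl⟩ | ⟨rfl, rfl⟩⟩ :=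
      h.isCycle_subset_insert ht he (hB.isCycle C hC) hCT
    · simp at hle
    · exact hle (encard_pair_le_two _ _)
    · exact hbal hi hC
  · intro C hCT D hDT hC hD
    obtain ⟨⟨x, hx⟩, rfl⟩ | ⟨i, hi, hC⟩ := h.isCycle_subset_insert ht he hC hCT <;>
      obtain ⟨⟨y, hy⟩, rfl⟩ | ⟨k, hk, hD⟩ := h.isCycle_subset_insert ht he hD hDT
    · rfl
    · exact absurd hx (h.not_isLoopAt hk)
    · exact absurd hy (h.not_isLoopAt hi)
    · obtain rfl := h.eq_of_mem hi hk
      grind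

lemma indep_image_compl (h : G.IsThickCycle v) (hB : G.IsBiased 𝓑) (hM : G.IsLiftMatroid 𝓑 M)
    {t : Fin (n + 1) → β} (ht : G.IsTransversal v t) (j : Fin (n + 1)) :
    M.Indep (t '' {j}ᶜ) := by
  have hno : ∀ C ⊆ t '' {j}ᶜ, ¬ G.IsCycle C := by
    intro C hCT hC
    have hj : t j ∉ t '' {j}ᶜ := by
      rintro ⟨i, hi, hij⟩
      exact hi (h.injective ht hij)
    have h1 := h.isCycle_subset_insert ht hj hC (hCT.trans (subset_insert _ _))
    have : t j ∈ C := by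
      obtain ⟨-, rfl⟩ | ⟨i, -, ⟨-, rfl⟩ | ⟨-, rfl⟩⟩ := h1 <;> simp
    exact hj (hCT this)
  exact hM.indep_of_unique (image_subset_edgeSet ht _) (fun C hCT hC ↦ hno C hCT (hB.isCycle C hC))
    fun C hCT _ _ hC ↦ absurd hC (hno C hCT)

lemma encard_image (h : G.IsThickCycle v) {t : Fin (n + 1) → β} (ht : G.IsTransversal v t)
    (J : Set (Fin (n + 1))) : (t '' J).encard = J.ncard := by
  rw [(h.injective ht).encard_image, J.toFinite.cast_ncard_eq]

lemma encard_insert_image (h : G.IsThickCycle v) {t : Fin (n + 1) → β} (ht : G.IsTransversal v t)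
    {j : Fin (n + 1)} {e : β} (he : e ∉ t '' {j}ᶜ) :
    (insert e (t '' {j}ᶜ)).encard = (n + 1 : ℕ) := by
  rw [encard_insert_of_notMem he, h.encard_image ht, ncard_compl, ncard_singleton]
  simp

/-- If `t` is balanced, then replacing its member `t k` by a parallel edge gives an unbalanced
Hamiltonian cycle, because the pair of parallel edges is unbalanced. -/
lemma notMem_of_range_mem (h : G.IsThickCycle v) (hB : G.IsBiased 𝓑) (hM : G.IsLiftMatroid 𝓑 M)
    (hS : M.IsSimple) {t : Fin (n + 1) → β} (ht : G.IsTransversal v t) {k : Fin (n + 1)} {s : β}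
    (hs : s ∈ G.edgeClass v k) (hsk : s ≠ t k) (hbal : range t ∈ 𝓑) :
    insert s (range t \ {t k}) ∉ 𝓑 := by
  intro h'
  refine (hM.isUnbalancedCycle_of_encard_le_two hS (h.isCycle_pair (ht k) hs hsk.symm)
    (encard_pair_le_two _ _)).2 ?_
  have hθ := (h.isTheta_transversal ht hs hsk).rotate.rotate.swap
  refine hB.theta {t k} (range t \ {t k}) {s} hθ ?_ ?_
  · rwa [union_sdiff_cancel (by simp)]
  · rwa [union_comm, singleton_union]

/-- In the presence of a pair of parallel edges, a Hamiltonian path together with an edge parallel to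
one of its members spans the lift matroid. -/
lemma eRank_eq (h : G.IsThickCycle v) (hB : G.IsBiased 𝓑) (hM : G.IsLiftMatroid 𝓑 M)
    (hS : M.IsSimple) {k : Fin (n + 1)} (hk : (G.edgeClass v k).Nontrivial) :
    M.eRank = (n + 1 : ℕ) := by
  obtain ⟨t, ht⟩ := h.exists_transversal
  obtain ⟨s, hs, hsk⟩ := hk.exists_ne (t k)
  set j := k + 1 with hj
  have hkj : k ≠ j := (fin_add_one_ne h.two_le k).symm
  have hsT : s ∉ t '' {j}ᶜ := by
    rintro ⟨i, -, rfl⟩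
    exact hsk (congrArg t (h.eq_of_mem (ht i) hs))
  have htkT : t k ∈ t '' {j}ᶜ := ⟨k, hkj, rfl⟩
  have hI := h.indep_insert hB hM hS ht hs.edge_mem hsT
    fun h' ↦ absurd (h.eq_of_mem hs h') hkj
  have hcard := h.encard_insert_image ht hsT
  set B := insert s (t '' {j}ᶜ) with hBdef
  have hBE : B ⊆ G.edgeSet := insert_subset hs.edge_mem (image_subset_edgeSet ht _)
  have hpair := h.isCycle_pair hs (ht k) hsk
  have hpairB : {s, t k} ⊆ B := by grind
  have hsp : M.E ⊆ M.closure B := by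
    intro e he
    rw [hM.1] at he
    obtain ⟨x, hx⟩ | ⟨i, hi⟩ := h.cover e he
    · exact hM.loop_mem_closure hS hpair (encard_pair_le_two _ _) hpairB hx
    by_cases hij : i = j
    swap
    · exact h.parallel_mem_closure hM hS hpair (encard_pair_le_two _ _) hpairB hBE hi (ht i)
        (.inr ⟨i, hij, rfl⟩)
    subst i
    have heB : e ∉ B := by
      rintro (rfl | ⟨k', hk', rfl⟩)
      · exact hkj (h.eq_of_mem hs hi)
      · exact hk' (h.eq_of_mem (ht k') hi)
    set t' := Function.update t j e with ht'def
    have ht' : G.IsTransversal v t' := by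
      intro k'
      obtain rfl | hne := eq_or_ne k' j
      · simpa [ht'def] using hi
      · simpa [ht'def, hne] using ht k'
    have ht'k : t' k = t k := by simp [ht'def, hkj]
    have hrange : range t' ⊆ insert e B := by
      rintro _ ⟨k', rfl⟩
      obtain rfl | hne := eq_or_ne k' j
      · simp [ht'def]
      · exact .inr (.inr ⟨k', hne, by simp [ht'def, hne]⟩)
    have het' : e ∈ range t' := ⟨j, by simp [ht'def]⟩
    have hne : e ≠ t' k := by
      rw [ht'k]
      rintro rfl
      exact heB (.inr htkT)
    rw [Matroid.mem_closure_iff_exists_isCircuit heB]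
    by_cases h1 : range t' ∈ 𝓑
    · exact ⟨_, hrange, (hM.2 _).2 (.balanced _ h1), het'⟩
    have hθ := h.isTheta_transversal ht' hs (ht'k ▸ hsk)
    by_cases h2 : {s} ∪ (range t' \ {t' k}) ∈ 𝓑
    · exact ⟨_, by grind, (hM.2 _).2 (.balanced _ h2), .inr ⟨het', hne⟩⟩
    refine ⟨_, ?_, (hM.2 _).2 (.theta _ _ _ hθ ?_ h2 ?_), .inr ⟨het', hne⟩⟩
    · grind
    · rw [ht'k, union_comm]
      exact (hM.isUnbalancedCycle_of_encard_le_two hS hpair (encard_pair_le_two _ _)).2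
    · rwa [union_sdiff_cancel (by simp)]
  have hbase : M.IsBase B := hI.isBase_of_ground_subset_closure hsp
  rw [← hbase.encard_eq_eRank, hcard]

end IsThickCycle

end Graph

/-! ### Contractions and rank in arbitrary matroids -/

/-- If `f` completes a superset `H` of `F` to a spanning set, and `H` does not span `e`, then `e` and
`f` lie in a common circuit of `M ／ F`: they are in the complement of a common hyperplane
containing `F`. -/
lemma Matroid.exists_isCircuit_contract {β : Type*} {M : Matroid β} {F H : Set β} {e f : β}
    (hFH : F ⊆ H) (hH : H ⊆ M.E) (hef : e ≠ f) (he : e ∈ M.E) (heH : e ∉ M.closure H)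
    (hfH : M.Spanning (insert f H)) : ∃ C, (M ／ F).IsCircuit C ∧ e ∈ C ∧ f ∈ C := by
  have heH' : e ∉ H := fun h ↦ heH (M.mem_closure_of_mem h)
  have h1 : e ∈ (M ／ F).closure (insert f (H \ F)) := by
    rw [M.contract_closure_eq, insert_union, sdiff_union_of_subset hFH, hfH.closure_eq]
    exact ⟨he, fun h ↦ heH' (hFH h)⟩
  have h2 : e ∉ (M ／ F).closure (H \ F) := by
    rw [M.contract_closure_eq, sdiff_union_of_subset hFH]
    exact fun h ↦ heH h.1
  rw [Matroid.mem_closure_iff_exists_isCircuit (by grind)] at h1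
  obtain ⟨C, hCX, hC, heC⟩ := h1
  refine ⟨C, hC, heC, by_contra fun hfC ↦ h2 ?_⟩
  rw [Matroid.mem_closure_iff_exists_isCircuit (by grind)]
  exact ⟨C, by grind, hC, heC⟩

/-- In a simple matroid every set of at least `k ≤ 2` elements has rank at least `k`. -/
lemma Matroid.IsSimple.le_eRk {β : Type*} {M : Matroid β} (hS : M.IsSimple) {X : Set β}
    (hX : X ⊆ M.E) {k : ℕ} (hk : k ≤ 2) (hkX : k ≤ X.encard) : k ≤ M.eRk X := by
  obtain ⟨Y, hYX, hY⟩ := exists_subset_encard_eq hkX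
  rw [← hY]
  refine Indep.encard_le_eRk_of_subset ?_ hYX
  rw [indep_iff_forall_subset_not_isCircuit (hYX.trans hX)]
  intro C hCY hC
  have h1 := (hS C hC).trans_le (encard_le_encard hCY)
  rw [hY] at h1
  have : 2 < k := by exact_mod_cast h1
  omega

namespace Graph

variable {α β : Type*} {G : Graph α β} {𝓑 : Set (Set β)} {n : ℕ} {v : Fin (n + 1) → α}
  {M : Matroid β}

/-! ### Rank bounds -/

/-- The indices of the parallel classes that `X` meets. -/
def hitClasses (G : Graph α β) (v : Fin (n + 1) → α) (X : Set β) : Set (Fin (n + 1)) :=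
  {i | (X ∩ G.edgeClass v i).Nonempty}

namespace IsThickCycle

lemma exists_transversal_hit (h : G.IsThickCycle v) (X : Set β) :
    ∃ t, G.IsTransversal v t ∧ ∀ i ∈ G.hitClasses v X, t i ∈ X := by
  have key : ∀ i, ∃ e ∈ G.edgeClass v i, i ∈ G.hitClasses v X → e ∈ X := by
    intro i
    by_cases hi : i ∈ G.hitClasses v X
    · obtain ⟨e, he⟩ := hi
      exact ⟨e, he.2, fun _ ↦ he.1⟩
    · obtain ⟨e, he⟩ := h.nonempty i
      exact ⟨e, he, fun h' ↦ absurd h' hi⟩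
  choose t ht using key
  exact ⟨t, fun i ↦ (ht i).1, fun i ↦ (ht i).2⟩

/-- One edge of `X` from each class that `X` meets, except class `j`, form an independent set. The class
`j` is left out because edges from all classes form a cycle, which may be balanced. -/
lemma ncard_le_eRk (h : G.IsThickCycle v) (hB : G.IsBiased 𝓑) (hM : G.IsLiftMatroid 𝓑 M)
    (X : Set β) (j : Fin (n + 1)) : ((G.hitClasses v X \ {j}).ncard : ℕ∞) ≤ M.eRk X := by
  obtain ⟨t, ht, htX⟩ := h.exists_transversal_hit X
  rw [← h.encard_image ht]
  refine ((h.indep_image_compl hB hM ht j).subset ?_).encard_le_eRk_of_subset ?_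
  · exact image_mono fun i hi ↦ hi.2
  · rintro _ ⟨i, hi, rfl⟩
    exact htX i hi.1

/-- An unbalanced cycle of length at most two in `X` raises the lower bound on the rank by one. -/
lemma ncard_add_one_le_eRk (h : G.IsThickCycle v) (hB : G.IsBiased 𝓑) (hM : G.IsLiftMatroid 𝓑 M)
    (hS : M.IsSimple) {D X : Set β} (hD : G.IsCycle D) (hD2 : D.encard ≤ 2) (hDX : D ⊆ X)
    {j : Fin (n + 1)} (hj : Disjoint D (G.edgeClass v j)) :
    (((G.hitClasses v X \ {j}).ncard + 1 : ℕ) : ℕ∞) ≤ M.eRk X := by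
  obtain ⟨t, ht, htX⟩ := h.exists_transversal_hit X
  obtain ⟨s, hsD, hs⟩ : ∃ s ∈ D, s ∉ t '' {j}ᶜ := by
    obtain ⟨l, x, hl, rfl⟩ | ⟨k, a, b, ha, hb, hab, rfl⟩ := h.cases_of_encard_le_two hD hD2
    · refine ⟨l, rfl, ?_⟩
      rintro ⟨i, -, rfl⟩
      exact h.not_isLoopAt (ht i) hl
    · by_contra! hcon
      obtain ⟨i, -, rfl⟩ := hcon a (by simp)
      obtain ⟨i', -, rfl⟩ := hcon b (by simp)
      exact hab (by rw [h.eq_of_mem (ht i) ha, h.eq_of_mem (ht i') hb])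
  have hsub : t '' (G.hitClasses v X \ {j}) ⊆ t '' {j}ᶜ := image_mono fun i hi ↦ hi.2
  have hI := h.indep_insert hB hM hS ht (hD.subset_edgeSet hsD) hs
    fun h' ↦ absurd h' (disjoint_left.1 hj hsD)
  have hcard : (insert s (t '' (G.hitClasses v X \ {j}))).encard =
      (((G.hitClasses v X \ {j}).ncard + 1 : ℕ) : ℕ∞) := by
    rw [encard_insert_of_notMem fun h' ↦ hs (hsub h'), h.encard_image ht]
    simp
  rw [← hcard]
  refine (hI.subset (insert_subset_insert hsub)).encard_le_eRk_of_subset ?_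
  refine insert_subset (hDX hsD) ?_
  rintro _ ⟨i, hi, rfl⟩
  exact htX i hi.1

lemma ncard_hit_sdiff {X : Set β} {j : Fin (n + 1)} (hj : (G.hitClasses v X)ᶜ ⊆ {j}) :
    (G.hitClasses v X \ {j}).ncard = n := by
  have : G.hitClasses v X \ {j} = {j}ᶜ := by
    ext i
    have := @hj i
    simp only [mem_compl_iff, mem_singleton_iff, mem_sdiff] at *
    tauto
  rw [this, ncard_compl, ncard_singleton]
  simp

/-- A set that meets all but at most one of the parallel classes has corank at most one. -/
lemma le_eRk_of_subsingleton (h : G.IsThickCycle v) (hB : G.IsBiased 𝓑) (hM : G.IsLiftMatroid 𝓑 M)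
    {X : Set β} (hX : (G.hitClasses v X)ᶜ.Subsingleton) : n ≤ M.eRk X := by
  obtain ⟨j, hj⟩ : ∃ j, (G.hitClasses v X)ᶜ ⊆ {j} := by
    obtain h0 | ⟨j, hj⟩ := hX.eq_empty_or_singleton
    exacts [⟨0, by simp [h0]⟩, ⟨j, hj.subset⟩]
  rw [← ncard_hit_sdiff hj]
  exact h.ncard_le_eRk hB hM X j

/-- A set that meets all but at most one of the parallel classes and contains an unbalanced cycle of
length at most two has full rank. -/
lemma add_one_le_eRk_of_subsingleton (h : G.IsThickCycle v) (hB : G.IsBiased 𝓑)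
    (hM : G.IsLiftMatroid 𝓑 M) (hS : M.IsSimple) {D X : Set β} (hD : G.IsCycle D)
    (hD2 : D.encard ≤ 2) (hDX : D ⊆ X) (hX : (G.hitClasses v X)ᶜ.Subsingleton) :
    (n + 1 : ℕ) ≤ M.eRk X := by
  obtain ⟨j, hj, hjD⟩ : ∃ j, (G.hitClasses v X)ᶜ ⊆ {j} ∧ Disjoint D (G.edgeClass v j) := by
    obtain h0 | ⟨j, hj⟩ := hX.eq_empty_or_singleton
    · obtain ⟨l, x, hl, rfl⟩ | ⟨k, a, b, ha, hb, hab, rfl⟩ := h.cases_of_encard_le_two hD hD2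
      · exact ⟨0, by simp [h0], by simpa using fun h' ↦ h.not_isLoopAt h' hl⟩
      · have hk := fin_add_one_ne h.two_le k
        refine ⟨k + 1, by simp [h0], ?_⟩
        rw [disjoint_left]
        rintro x (rfl | rfl) hx
        exacts [hk (h.eq_of_mem hx ha), hk (h.eq_of_mem hx hb)]
    · refine ⟨j, hj.subset, disjoint_left.2 fun x hx hx' ↦ ?_⟩
      have : j ∈ (G.hitClasses v X)ᶜ := by simp [hj]
      exact this ⟨x, hDX hx, hx'⟩
  rw [← ncard_hit_sdiff hj]
  exact h.ncard_add_one_le_eRk hB hM hS hD hD2 hDX hjD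

/-- The edges outside two parallel classes do not span any member of these classes, since a cycle that
meets one of the two classes, and is not a pair of parallel edges, meets both. -/
lemma notMem_closure_of_disjoint (h : G.IsThickCycle v) (hB : G.IsBiased 𝓑)
    (hM : G.IsLiftMatroid 𝓑 M) {H : Set β} {i j : Fin (n + 1)} (hij : i ≠ j)
    (hi : Disjoint H (G.edgeClass v i)) (hj : Disjoint H (G.edgeClass v j)) {e : β}
    (he : e ∈ G.edgeClass v i) : e ∉ M.closure H := by
  have heH : e ∉ H := fun h' ↦ disjoint_left.1 hi h' he
  rw [Matroid.mem_closure_iff_exists_isCircuit heH]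
  rintro ⟨K, hKH, hK, heK⟩
  obtain ⟨C, hCK, hC, heC⟩ := ((hM.2 K).1 hK).exists_isCycle hB heK
  have hCH := hCK.trans hKH
  have honly : ∀ a ∈ C, a ∈ G.edgeClass v i → a = e := fun a ha hai ↦
    (hCH ha).resolve_right fun h' ↦ disjoint_left.1 hi h' hai
  obtain ⟨l, x, hl, rfl⟩ | ⟨k, a, b, ha, hb, hab, rfl⟩ | ⟨t, ht, rfl⟩ := h.isCycle_cases hC
  · rw [mem_singleton_iff] at heC
    subst heC
    exact h.not_isLoopAt he hl
  · have hki : k = i := by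
      obtain rfl | rfl := heC
      exacts [h.eq_of_mem ha he, h.eq_of_mem hb he]
    subst hki
    exact hab ((honly a (by simp) ha).trans (honly b (by simp) hb).symm)
  · obtain h' | h' := hCH ⟨j, rfl⟩
    · exact hij (h.eq_of_mem he (h' ▸ ht j))
    · exact disjoint_left.1 hj h' (ht j)

end IsThickCycle

/-! ### Unbreakability -/

namespace IsThickCycle

lemma spanning_of_le_eRk (h : G.IsThickCycle v) (hB : G.IsBiased 𝓑) (hM : G.IsLiftMatroid 𝓑 M)
    (hS : M.IsSimple) {k : Fin (n + 1)} (hk : (G.edgeClass v k).Nontrivial) {X : Set β}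
    (hX : X ⊆ M.E) (hr : (n + 1 : ℕ) ≤ M.eRk X) : M.Spanning X := by
  have hrank := h.eRank_eq hB hM hS hk
  have : M.RankFinite := by
    rw [← Matroid.eRank_ne_top_iff, hrank]
    exact ENat.natCast_ne_top _
  rw [Matroid.spanning_iff_eRk_le, hrank]
  exact hr

/-- A Hamiltonian path `t '' {j}ᶜ` that contains `F` and spans neither `e` nor `f` shows that `e` and
`f` lie in a common circuit of the contraction of `F`. -/
lemma exists_isCircuit_contract_of_transversal (h : G.IsThickCycle v) (hB : G.IsBiased 𝓑)
    (hM : G.IsLiftMatroid 𝓑 M) (hS : M.IsSimple) {k : Fin (n + 1)}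
    (hk : (G.edgeClass v k).Nontrivial) {F : Set β} {e f : β} (hef : e ≠ f) (he : e ∈ G.edgeSet)
    (hf : f ∈ G.edgeSet) {t : Fin (n + 1) → β} (ht : G.IsTransversal v t) {j : Fin (n + 1)}
    (hF : F ⊆ t '' {j}ᶜ) (heT : e ∉ t '' {j}ᶜ)
    (hbal : e ∈ G.edgeClass v j → insert e (t '' {j}ᶜ) ∉ 𝓑) (hfT : f ∉ t '' {j}ᶜ)
    (hfj : f ∉ G.edgeClass v j) : ∃ C, (M ／ F).IsCircuit C ∧ e ∈ C ∧ f ∈ C := by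
  have hI := h.indep_image_compl hB hM ht j
  have hfI := h.indep_insert hB hM hS ht hf hfT fun h' ↦ absurd h' hfj
  refine Matroid.exists_isCircuit_contract hF hI.subset_ground hef (hM.1 ▸ he) ?_ ?_
  · rw [hI.notMem_closure_iff_of_notMem heT (hM.1 ▸ he)]
    exact h.indep_insert hB hM hS ht he heT hbal
  · refine h.spanning_of_le_eRk hB hM hS hk hfI.subset_ground ?_
    rw [hfI.eRk_eq_encard, h.encard_insert_image ht hfT]

/-- Two edges outside a flat `F`, one of which is a loop or parallel to an edge of `F`, lie in a common
circuit of `M ／ F`. Here `F` contains no cycle of length at most two, so it extends to a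
Hamiltonian path; the path is chosen so that it spans neither edge. -/
lemma exists_isCircuit_contract_of_hit (h : G.IsThickCycle v) (hB : G.IsBiased 𝓑)
    (hM : G.IsLiftMatroid 𝓑 M) (hS : M.IsSimple)
    (hpairs : ∀ i j, i ≠ j → (G.edgeClass v i).Nontrivial ∨ (G.edgeClass v j).Nontrivial)
    {F : Set β} (hF : M.IsFlat F) (hmiss : (G.hitClasses v F)ᶜ.Nontrivial) {e f : β}
    (hef : e ≠ f) (he : e ∈ G.edgeSet) (heF : e ∉ F) (hf : f ∈ G.edgeSet) (hfF : f ∉ F)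
    (hfhit : ∀ i, f ∈ G.edgeClass v i → i ∈ G.hitClasses v F) :
    ∃ C, (M ／ F).IsCircuit C ∧ e ∈ C ∧ f ∈ C := by
  have hFE : F ⊆ G.edgeSet := hM.1 ▸ hF.subset_ground
  obtain ⟨k, hk⟩ : ∃ k, (G.edgeClass v k).Nontrivial :=
    (hpairs _ _ (fin_add_one_ne h.two_le 0)).elim (fun h ↦ ⟨_, h⟩) fun h ↦ ⟨_, h⟩
  have hshort : ∀ D ⊆ F, G.IsCycle D → ¬ D.encard ≤ 2 := by
    intro D hDF hD hD2
    apply hfF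
    rw [← hF.closure]
    obtain ⟨x, hx⟩ | ⟨i, hi⟩ := h.cover f hf
    · exact hM.loop_mem_closure hS hD hD2 hDF hx
    · obtain ⟨s, hsF, hs⟩ := hfhit i hi
      exact h.parallel_mem_closure hM hS hD hD2 hDF hFE hi hs hsF
  have hFT : ∀ t, G.IsTransversal v t → (∀ i ∈ G.hitClasses v F, t i ∈ F) →
      ∀ j ∉ G.hitClasses v F, F ⊆ t '' {j}ᶜ := by
    intro t ht htF j hj a ha
    obtain ⟨x, hx⟩ | ⟨i, hi⟩ := h.cover a (hFE ha)
    · exact absurd (by simp) (hshort {a} (by simpa) hx.isCycle)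
    · have hiF : i ∈ G.hitClasses v F := ⟨a, ha, hi⟩
      refine ⟨i, fun hij ↦ hj (hij ▸ hiF), ?_⟩
      by_contra hne
      exact hshort {t i, a} (pair_subset (htF i hiF) ha) (h.isCycle_pair (ht i) hi hne)
        (encard_pair_le_two _ _)
  have hnot : ∀ t, G.IsTransversal v t → (∀ i ∈ G.hitClasses v F, t i ∈ F) → ∀ g ∉ F,
      (∀ i, g ∈ G.edgeClass v i → i ∈ G.hitClasses v F) → ∀ j, g ∉ t '' {j}ᶜ := by
    rintro t ht htF _ hgF hg j ⟨i, -, rfl⟩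
    exact hgF (htF i (hg i (ht i)))
  by_cases hehit : ∀ i, e ∈ G.edgeClass v i → i ∈ G.hitClasses v F
  · obtain ⟨t, ht, htF⟩ := h.exists_transversal_hit F
    obtain ⟨j, hj⟩ := hmiss.nonempty
    exact h.exists_isCircuit_contract_of_transversal hB hM hS hk hef he hf ht (hFT t ht htF j hj)
      (hnot t ht htF e heF hehit j) (fun h' ↦ absurd (hehit j h') hj)
      (hnot t ht htF f hfF hfhit j) fun h' ↦ hj (hfhit j h')
  push Not at hehit
  obtain ⟨i, hei, hiF⟩ := hehit
  obtain ⟨j, hj, hji⟩ := hmiss.exists_ne i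
  by_cases hi : ∃ e' ∈ G.edgeClass v i, e' ≠ e
  · -- A path through an edge parallel to `e` does not span `e`.
    obtain ⟨e', he', hne⟩ := hi
    obtain ⟨t, ht, htF'⟩ := h.exists_transversal_hit (insert e' F)
    have htF : ∀ l ∈ G.hitClasses v F, t l ∈ F := by
      rintro l hl
      obtain ⟨s, hsF, hs⟩ := hl
      obtain h' | h' := htF' l ⟨s, .inr hsF, hs⟩
      · have hlt := ht l
        rw [h'] at hlt
        rw [h.eq_of_mem hlt he'] at hs
        exact absurd ⟨s, hsF, hs⟩ hiF
      · exact h'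
    have hti : t i = e' := (htF' i ⟨e', .inl rfl, he'⟩).resolve_right
      fun h' ↦ hiF ⟨_, h', ht i⟩
    refine h.exists_isCircuit_contract_of_transversal hB hM hS hk hef he hf ht (hFT t ht htF j hj)
      ?_ (fun h' ↦ absurd (h.eq_of_mem h' hei) hji) (hnot t ht htF f hfF hfhit j)
      fun h' ↦ hj (hfhit j h')
    rintro ⟨l, -, rfl⟩
    exact hne (h.eq_of_mem (ht l) hei ▸ hti.symm)
  · -- The edge `e` is alone in its class, so the path has to avoid this class. If it forms a balanced
    -- cycle with `e`, then one of its edges outside `F` is replaced by a parallel edge.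
    push Not at hi
    obtain ⟨t, ht, htF, hbal⟩ : ∃ t, G.IsTransversal v t ∧ (∀ l ∈ G.hitClasses v F, t l ∈ F) ∧
        range t ∉ 𝓑 := by
      obtain ⟨t, ht, htF⟩ := h.exists_transversal_hit F
      by_cases hbal : range t ∈ 𝓑
      swap
      · exact ⟨t, ht, htF, hbal⟩
      have hjnt : (G.edgeClass v j).Nontrivial := (hpairs i j hji.symm).resolve_left fun hnt ↦ by
        obtain ⟨e', he', hne⟩ := hnt.exists_ne e
        exact hne (hi e' he')
      obtain ⟨s, hs, hsj⟩ := hjnt.exists_ne (t j)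
      refine ⟨Function.update t j s, fun l ↦ ?_, fun l hl ↦ ?_, ?_⟩
      · obtain rfl | hne := eq_or_ne l j
        · simpa using hs
        · simpa [hne] using ht l
      · have hne : l ≠ j := fun h' ↦ hj (h' ▸ hl)
        simpa [hne] using htF l hl
      · have := h.notMem_of_range_mem hB hM hS ht hs hsj hbal
        convert this using 2
        ext a
        simp only [mem_range, mem_insert_iff, mem_sdiff, mem_singleton_iff]
        constructor
        · rintro ⟨l, rfl⟩
          obtain rfl | hne := eq_or_ne l j
          · simp
          · exact .inr ⟨⟨l, by simp [hne]⟩, by simpa [hne] using (h.injective ht).ne hne⟩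
        · rintro (rfl | ⟨⟨l, rfl⟩, hl⟩)
          · exact ⟨j, by simp⟩
          · have hne : l ≠ j := fun h' ↦ hl (congrArg t h')
            exact ⟨l, by simp [hne]⟩
    have hti : t i = e := hi _ (ht i)
    have hrange : insert e (t '' {i}ᶜ) = range t := by
      rw [← hti, ← image_insert_eq, insert_eq, union_compl_self, image_univ]
    refine h.exists_isCircuit_contract_of_transversal hB hM hS hk hef he hf ht (hFT t ht htF i hiF)
      ?_ (fun _ ↦ hrange ▸ hbal) (hnot t ht htF f hfF hfhit i) fun h' ↦ hiF (hfhit i h')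
    rintro ⟨l, hl, rfl⟩
    exact hl (h.eq_of_mem (ht l) hei)

/-- Two edges outside `F` in parallel classes that `F` does not meet are separated from `F` by
deleting two such classes. -/
lemma exists_isCircuit_contract_of_missed (hn : 3 ≤ n) (h : G.IsThickCycle v) (hB : G.IsBiased 𝓑)
    (hM : G.IsLiftMatroid 𝓑 M) (hS : M.IsSimple)
    (hpairs : ∀ i j, i ≠ j → (G.edgeClass v i).Nontrivial ∨ (G.edgeClass v j).Nontrivial)
    {F : Set β} (hFE : F ⊆ G.edgeSet) (hmiss : (G.hitClasses v F)ᶜ.Nontrivial) {e f : β}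
    (hef : e ≠ f) {i j : Fin (n + 1)} (hei : e ∈ G.edgeClass v i) (hfj : f ∈ G.edgeClass v j)
    (hi : i ∉ G.hitClasses v F) (hj : j ∉ G.hitClasses v F) :
    ∃ C, (M ／ F).IsCircuit C ∧ e ∈ C ∧ f ∈ C := by
  obtain ⟨l, hl, hli, hjl⟩ : ∃ l ∉ G.hitClasses v F, l ≠ i ∧ (j = i ∨ j = l) := by
    obtain rfl | hne := eq_or_ne j i
    · obtain ⟨l, hl, hlj⟩ := hmiss.exists_ne j
      exact ⟨l, hl, hlj, .inl rfl⟩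
    · exact ⟨j, hj, hne, .inr rfl⟩
  obtain ⟨k, hk, hki, hkl⟩ : ∃ k, (G.edgeClass v k).Nontrivial ∧ k ≠ i ∧ k ≠ l := by
    have h2 : ({i, l}ᶜ : Set (Fin (n + 1))).Nontrivial := by
      rw [← one_lt_ncard_iff_nontrivial, ncard_compl, ncard_pair hli.symm, Nat.card_fin]
      omega
    obtain ⟨a, ha, b, hb, hab⟩ := h2
    simp only [mem_compl_iff, mem_insert_iff, mem_singleton_iff, not_or] at ha hb
    obtain h' | h' := hpairs a b hab
    exacts [⟨a, h', ha⟩, ⟨b, h', hb⟩]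
  set H := G.edgeSet \ (G.edgeClass v i ∪ G.edgeClass v l) with hH
  have hHE : H ⊆ M.E := hM.1 ▸ sdiff_subset
  have hfH : insert f H ⊆ M.E := insert_subset (hM.1 ▸ hfj.edge_mem) hHE
  have hmem : ∀ {a m}, a ∈ G.edgeClass v m → m ≠ i → m ≠ l → a ∈ H := by
    rintro a m ha h1 h2
    refine ⟨ha.edge_mem, ?_⟩
    rintro (h' | h')
    exacts [h1 (h.eq_of_mem ha h'), h2 (h.eq_of_mem ha h')]
  refine Matroid.exists_isCircuit_contract (H := H) ?_ hHE hef (hM.1 ▸ hei.edge_mem) ?_ ?_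
  · intro a ha
    refine ⟨hFE ha, ?_⟩
    rintro (h' | h')
    exacts [hi ⟨a, ha, h'⟩, hl ⟨a, ha, h'⟩]
  · exact h.notMem_closure_of_disjoint hB hM hli.symm
      (disjoint_sdiff_left.mono_right subset_union_left)
      (disjoint_sdiff_left.mono_right subset_union_right) hei
  · refine h.spanning_of_le_eRk hB hM hS hk hfH ?_
    obtain ⟨a, ha, b, hb, hab⟩ := hk
    refine h.add_one_le_eRk_of_subsingleton hB hM hS (h.isCycle_pair ha hb hab)
      (encard_pair_le_two _ _) (pair_subset (.inr (hmem ha hki hkl)) (.inr (hmem hb hki hkl))) ?_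
    have hmiss' : ∀ m ∈ (G.hitClasses v (insert f H))ᶜ, m ≠ j ∧ (m = i ∨ m = l) := by
      intro m hm
      refine ⟨?_, ?_⟩
      · rintro rfl
        exact hm ⟨f, .inl rfl, hfj⟩
      · by_contra! h'
        obtain ⟨a, ha⟩ := h.nonempty m
        exact hm ⟨a, .inr (hmem ha h'.1 h'.2), ha⟩
    intro m hm m' hm'
    have := hmiss' m hm
    have := hmiss' m' hm'
    grind

/-- Contracting a flat of the lift matroid leaves a connected matroid. -/
lemma isConnected_contract (hn : 3 ≤ n) (h : G.IsThickCycle v) (hB : G.IsBiased 𝓑)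
    (hM : G.IsLiftMatroid 𝓑 M) (hS : M.IsSimple)
    (hpairs : ∀ i j, i ≠ j → (G.edgeClass v i).Nontrivial ∨ (G.edgeClass v j).Nontrivial)
    {F : Set β} (hF : M.IsFlat F) : (M ／ F).IsConnected := by
  intro e he f hf hef
  rw [Matroid.contract_ground] at he hf
  obtain ⟨heE, heF⟩ := he
  obtain ⟨hfE, hfF⟩ := hf
  have he : e ∈ G.edgeSet := hM.1 ▸ heE
  have hf : f ∈ G.edgeSet := hM.1 ▸ hfE
  have hFE : F ⊆ G.edgeSet := hM.1 ▸ hF.subset_ground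
  obtain ⟨k, hk⟩ : ∃ k, (G.edgeClass v k).Nontrivial :=
    (hpairs _ _ (fin_add_one_ne h.two_le 0)).elim (fun h ↦ ⟨_, h⟩) fun h ↦ ⟨_, h⟩
  by_cases hmiss : (G.hitClasses v F)ᶜ.Subsingleton
  · -- Here `F` has corank at most one, so `F` itself serves as the hyperplane.
    refine Matroid.exists_isCircuit_contract Subset.rfl hF.subset_ground hef heE ?_ ?_
    · rwa [hF.closure]
    · refine h.spanning_of_le_eRk hB hM hS hk (insert_subset hfE hF.subset_ground) ?_
      rw [Matroid.eRk_insert_eq_add_one ⟨hfE, by rwa [hF.closure]⟩]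
      push_cast
      gcongr
      exact h.le_eRk_of_subsingleton hB hM hmiss
  rw [not_subsingleton_iff] at hmiss
  by_cases hfhit : ∀ i, f ∈ G.edgeClass v i → i ∈ G.hitClasses v F
  · exact h.exists_isCircuit_contract_of_hit hB hM hS hpairs hF hmiss hef he heF hf hfF hfhit
  by_cases hehit : ∀ i, e ∈ G.edgeClass v i → i ∈ G.hitClasses v F
  · obtain ⟨C, hC, h1, h2⟩ := h.exists_isCircuit_contract_of_hit hB hM hS hpairs hF hmiss hef.symm
      hf hfF he heF hehit
    exact ⟨C, hC, h2, h1⟩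
  push Not at hfhit hehit
  obtain ⟨j, hfj, hj⟩ := hfhit
  obtain ⟨i, hei, hi⟩ := hehit
  exact h.exists_isCircuit_contract_of_missed hn hB hM hS hpairs hFE hmiss hef hei hfj hi hj

lemma isUnbreakable (hn : 3 ≤ n) (h : G.IsThickCycle v) (hB : G.IsBiased 𝓑)
    (hM : G.IsLiftMatroid 𝓑 M) (hS : M.IsSimple)
    (hpairs : ∀ i j, i ≠ j → (G.edgeClass v i).Nontrivial ∨ (G.edgeClass v j).Nontrivial) :
    M.IsUnbreakable := by
  have hempty : M.IsFlat ∅ := by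
    have : M.Loopless := by
      rw [Matroid.loopless_iff_forall_not_isLoop]
      intro e _ he
      have := hS _ (Matroid.singleton_isCircuit.2 he)
      simp at this
    rw [M.isFlat_iff_closure_eq]
    exact M.loops_eq_empty
  refine ⟨?_, fun F hF ↦ h.isConnected_contract hn hB hM hS hpairs hF⟩
  have := h.isConnected_contract hn hB hM hS hpairs hempty
  rwa [M.contract_empty] at this

/-! ### Connectivity -/

/-- If all parallel classes but at most one have two members, then `M` is `3`-connected. -/
lemma isNConnected_three (hn : 3 ≤ n) (h : G.IsThickCycle v) (hB : G.IsBiased 𝓑)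
    (hM : G.IsLiftMatroid 𝓑 M) (hS : M.IsSimple)
    (hpairs : ∀ i j, i ≠ j → (G.edgeClass v i).Nontrivial ∨ (G.edgeClass v j).Nontrivial) :
    M.IsNConnected 3 := by
  rintro k - hk X ⟨hXE, hkX, hkY, hlt⟩
  have hYE : M.E \ X ⊆ M.E := sdiff_subset
  have hcover : ∀ {e i}, e ∈ G.edgeClass v i → e ∈ X ∨ e ∈ M.E \ X := by
    intro e i he
    have : e ∈ M.E := hM.1 ▸ he.edge_mem
    by_cases e ∈ X <;> grind
  set Y := M.E \ X with hY
  clear_value Y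
  obtain ⟨c, hc⟩ : ∃ c, (G.edgeClass v c).Nontrivial :=
    (hpairs _ _ (fin_add_one_ne h.two_le 0)).elim (fun h ↦ ⟨_, h⟩) fun h ↦ ⟨_, h⟩
  rw [h.eRank_eq hB hM hS hc] at hlt
  have hlow : ∀ a b : ℕ, a ≤ M.eRk X → b ≤ M.eRk Y → a + b < n + 1 + k := by
    intro a b ha hb
    exact_mod_cast (add_le_add ha hb).trans_lt hlt
  -- A set that misses two classes leaves a pair of parallel edges to its complement.
  have hshort : ∀ {Z W : Set β}, (∀ {e i}, e ∈ G.edgeClass v i → e ∈ Z ∨ e ∈ W) →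
      (G.hitClasses v Z)ᶜ.Nontrivial → ∃ D ⊆ W, G.IsCycle D ∧ D.encard ≤ 2 := by
    rintro Z W hZW ⟨i, hi, j, hj, hij⟩
    have : ∀ i ∉ G.hitClasses v Z, (G.edgeClass v i).Nontrivial →
        ∃ D ⊆ W, G.IsCycle D ∧ D.encard ≤ 2 := by
      rintro i hi ⟨a, ha, b, hb, hab⟩
      exact ⟨{a, b}, pair_subset ((hZW ha).resolve_left fun h' ↦ hi ⟨a, h', ha⟩)
        ((hZW hb).resolve_left fun h' ↦ hi ⟨b, h', hb⟩), h.isCycle_pair ha hb hab,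
        encard_pair_le_two _ _⟩
    exact (hpairs i j hij).elim (this i hi) (this j hj)
  -- If `Z` misses at most one class, then `Z` has full rank, or both sides have rank at least `n`.
  have hside : ∀ {Z W : Set β}, (∀ {e i}, e ∈ G.edgeClass v i → e ∈ Z ∨ e ∈ W) →
      (∀ a b : ℕ, a ≤ M.eRk Z → b ≤ M.eRk W → a + b < n + 1 + k) → W ⊆ M.E → k ≤ W.encard →
      ¬ (G.hitClasses v Z)ᶜ.Subsingleton := by
    intro Z W hZW hlow hWE hkW hZ
    by_cases hD : ∃ D ⊆ Z, G.IsCycle D ∧ D.encard ≤ 2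
    · obtain ⟨D, hDZ, hD, hD2⟩ := hD
      have := hlow (n + 1) k (h.add_one_le_eRk_of_subsingleton hB hM hS hD hD2 hDZ hZ)
        (hS.le_eRk hWE (by omega) hkW)
      omega
    · have hW : (G.hitClasses v W)ᶜ.Subsingleton := by
        rw [← not_nontrivial_iff]
        exact fun h' ↦ hD (hshort (fun he ↦ (hZW he).symm) h')
      have := hlow n n (h.le_eRk_of_subsingleton hB hM hZ) (h.le_eRk_of_subsingleton hB hM hW)
      omega
  have hX := hside hcover hlow hYE hkY
  have hYn := hside (fun he ↦ (hcover he).symm)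
    (fun a b ha hb ↦ by have := hlow b a hb ha; omega) hXE hkX
  rw [not_subsingleton_iff] at hX hYn
  obtain ⟨D, hDY, hD, hD2⟩ := hshort hcover hX
  obtain ⟨D', hDX, hD', hD2'⟩ := hshort (fun he ↦ (hcover he).symm) hYn
  have hrank : ∀ {Z D : Set β}, (G.hitClasses v Z)ᶜ.Nontrivial → D ⊆ Z → G.IsCycle D →
      D.encard ≤ 2 → (((G.hitClasses v Z).ncard + 1 : ℕ) : ℕ∞) ≤ M.eRk Z := by
    intro Z D hZ hDZ hD hD2
    obtain ⟨j, hj⟩ := hZ.nonempty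
    have := h.ncard_add_one_le_eRk hB hM hS hD hD2 hDZ (j := j)
      (disjoint_left.2 fun x hx hx' ↦ hj ⟨x, hDZ hx, hx'⟩)
    rwa [sdiff_singleton_eq_self hj] at this
  have h1 := hlow _ _ (hrank hX hDX hD' hD2') (hrank hYn hDY hD hD2)
  have h2 : G.hitClasses v X ∪ G.hitClasses v Y = univ := by
    refine eq_univ_of_forall fun i ↦ ?_
    obtain ⟨a, ha⟩ := h.nonempty i
    exact (hcover ha).imp (fun h' ↦ ⟨a, h', ha⟩) fun h' ↦ ⟨a, h', ha⟩
  have h3 := ncard_union_le (G.hitClasses v X) (G.hitClasses v Y)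
  rw [h2, ncard_univ, Nat.card_fin] at h3
  omega

/-- A nonloop edge lies in no cycle of length two exactly if it is alone in its parallel class. -/
lemma mem_nonloopsInNoTwoCycle_iff (h : G.IsThickCycle v) {e : β} :
    e ∈ G.nonloopsInNoTwoCycle ↔ ∃ i, e ∈ G.edgeClass v i ∧ ¬ (G.edgeClass v i).Nontrivial := by
  constructor
  · rintro ⟨heE, hloop, hcyc⟩
    obtain ⟨i, hi⟩ := (h.cover e heE).resolve_left fun ⟨x, hx⟩ ↦ hloop x hx
    refine ⟨i, hi, fun hnt ↦ hcyc ?_⟩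
    obtain ⟨a, ha, hae⟩ := hnt.exists_ne e
    exact ⟨{a, e}, h.isCycle_pair ha hi hae, encard_pair hae, by simp⟩
  · rintro ⟨i, hi, hnt⟩
    refine ⟨hi.edge_mem, fun x ↦ h.not_isLoopAt hi, ?_⟩
    rintro ⟨C, hC, hC2, heC⟩
    obtain ⟨l, x, hl, rfl⟩ | ⟨k, a, b, ha, hb, hab, rfl⟩ := h.cases_of_encard_le_two hC hC2.le
    · simp at hC2
    · have : k = i := by
        obtain rfl | rfl := heC
        exacts [h.eq_of_mem ha hi, h.eq_of_mem hb hi]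
      subst this
      exact hnt ⟨a, ha, b, hb, hab⟩

lemma nonloopsInNoTwoCycle_subsingleton_iff (h : G.IsThickCycle v) :
    G.nonloopsInNoTwoCycle.Subsingleton ↔
      ∀ i j, i ≠ j → (G.edgeClass v i).Nontrivial ∨ (G.edgeClass v j).Nontrivial := by
  constructor
  · intro hs i j hij
    by_contra! hcon
    obtain ⟨a, ha⟩ := h.nonempty i
    obtain ⟨b, hb⟩ := h.nonempty j
    rw [← not_nontrivial_iff, ← not_nontrivial_iff] at hcon
    have hab := hs (h.mem_nonloopsInNoTwoCycle_iff.2 ⟨i, ha, hcon.1⟩)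
      (h.mem_nonloopsInNoTwoCycle_iff.2 ⟨j, hb, hcon.2⟩)
    subst hab
    exact hij (h.eq_of_mem ha hb)
  · intro hp a ha b hb
    obtain ⟨i, hai, hi⟩ := h.mem_nonloopsInNoTwoCycle_iff.1 ha
    obtain ⟨j, hbj, hj⟩ := h.mem_nonloopsInNoTwoCycle_iff.1 hb
    obtain rfl | hij := eq_or_ne i j
    · rw [not_nontrivial_iff] at hi
      exact hi hai hbj
    · exact absurd (hp i j hij) (by tauto)

lemma le_encard_ground_sdiff (h : G.IsThickCycle v) (hM : G.IsLiftMatroid 𝓑 M) {X : Set β}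
    (hX : X.encard ≤ 2) (hn : 3 ≤ n) : 2 ≤ (M.E \ X).encard := by
  obtain ⟨t, ht⟩ := h.exists_transversal
  have h1 : (n + 1 : ℕ) ≤ M.E.encard := by
    have := encard_le_encard (image_subset_edgeSet ht univ)
    rw [h.encard_image ht, ncard_univ, Nat.card_fin] at this
    rwa [hM.1]
  by_contra! hlt
  have h2 : (4 : ℕ∞) ≤ (n + 1 : ℕ) := by exact_mod_cast (by omega : 4 ≤ n + 1)
  have h3 : M.E.encard ≤ (M.E \ X).encard + X.encard := by
    rw [← encard_union_eq disjoint_sdiff_left]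
    exact encard_le_encard (by grind)
  have h4 : (M.E \ X).encard + X.encard ≤ 1 + 2 := add_le_add (Order.le_of_lt_succ hlt) hX
  have := (h2.trans h1).trans (h3.trans h4)
  norm_num at this

/-- A circuit with at most two elements is one side of a separation. -/
lemma isSimple_of_isNConnected (hn : 3 ≤ n) (h : G.IsThickCycle v) (hM : G.IsLiftMatroid 𝓑 M)
    (hfin : M.RankFinite) (hconn : M.IsNConnected 3) : M.IsSimple := by
  intro C hC
  by_contra! hC2
  obtain ⟨k, hk⟩ := ENat.ne_top_iff_exists.1 (hC2.trans_lt (by exact ENat.natCast_lt_top 2)).ne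
  rw [← hk] at hC2
  have hk2 : k ≤ 2 := by exact_mod_cast hC2
  have hk1 : 1 ≤ k := by
    have := one_le_encard_iff_nonempty.2 hC.nonempty
    rw [← hk] at this
    exact_mod_cast this
  refine hconn k hk1 (by omega) C ⟨hC.subset_ground, hk.le, ?_, ?_⟩
  · exact hC2.trans (h.le_encard_ground_sdiff hM (hk ▸ hC2) hn)
  · have h1 := hC.eRk_add_one_eq
    have h2 := M.eRk_le_eRank (M.E \ C)
    have h3 := M.eRank_ne_top_iff.2 hfin
    rw [← hk] at h1
    have h4 : M.eRk C ≠ ⊤ := ((M.eRk_le_eRank C).trans_lt h3.lt_top).ne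
    lift M.eRk C to ℕ using h4 with c
    lift M.eRank to ℕ using h3 with r
    lift M.eRk (M.E \ C) to ℕ using (h2.trans_lt (ENat.natCast_lt_top r)).ne with s
    norm_cast at *
    omega

/-- Two edges that are alone in their parallel classes are one side of a separation: every circuit
through one of them contains the other. -/
lemma nontrivial_or_of_isNConnected (hn : 3 ≤ n) (h : G.IsThickCycle v) (hB : G.IsBiased 𝓑)
    (hM : G.IsLiftMatroid 𝓑 M) (hfin : M.RankFinite) (hconn : M.IsNConnected 3)
    (i j : Fin (n + 1)) (hij : i ≠ j) :
    (G.edgeClass v i).Nontrivial ∨ (G.edgeClass v j).Nontrivial := by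
  by_contra! hcon
  obtain ⟨e, he⟩ := h.nonempty i
  obtain ⟨f, hf⟩ := h.nonempty j
  have hef : e ≠ f := by rintro rfl; exact hij (h.eq_of_mem he hf)
  have hdis : ∀ {l a}, a ∈ G.edgeClass v l → (G.edgeClass v l).Subsingleton → a ∈ ({e, f} : Set β) →
      Disjoint (M.E \ {e, f}) (G.edgeClass v l) := by
    intro l a ha hl hmem
    rw [disjoint_right]
    intro x hx hx'
    exact hx'.2 (hl hx ha ▸ hmem)
  have hcl := h.notMem_closure_of_disjoint hB hM hij (hdis he hcon.1 (by simp))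
    (hdis hf hcon.2 (by simp)) he
  have heE : e ∈ M.E := hM.1 ▸ he.edge_mem
  have hfE : f ∈ M.E := hM.1 ▸ hf.edge_mem
  refine hconn 2 (by omega) (by omega) {e, f} ⟨pair_subset heE hfE, (encard_pair hef).ge,
    h.le_encard_ground_sdiff hM (encard_pair_le_two _ _) hn, ?_⟩
  have h1 := M.eRk_insert_eq_add_one ⟨heE, hcl⟩
  have h2 := M.eRk_le_eRank (insert e (M.E \ {e, f}))
  have h3 := M.eRank_ne_top_iff.2 hfin
  have h4 := (M.eRk_le_encard {e, f}).trans (encard_pair_le_two e f)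
  rw [h1] at h2
  have h5 := ((M.eRk_le_eRank (M.E \ {e, f})).trans_lt h3.lt_top).ne
  have h6 := ((M.eRk_le_eRank {e, f}).trans_lt h3.lt_top).ne
  lift M.eRk {e, f} to ℕ using h6 with c
  lift M.eRank to ℕ using h3 with r
  lift M.eRk (M.E \ {e, f}) to ℕ using h5 with s
  norm_cast at *
  omega

end IsThickCycle

end Graph

theorem theorem1p5 {α β : Type*} (G : Graph α β) (hE : G.edgeSet.Finite)
    (hV : 6 < G.vertexSet.encard) (hG : G.SimplificationIsCycle)
    (M : Matroid β) (hM : M.IsLiftedGraphicOn G) :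
    (M.IsNConnected 3 ↔ M.IsSimple ∧ G.nonloopsInNoTwoCycle.Subsingleton) ∧
      (M.IsNConnected 3 → M.IsUnbreakable) := by
  obtain ⟨n, v, hn6, h⟩ := hG.exists_isThickCycle hV
  obtain ⟨𝓑, hB, hM⟩ := hM
  have hn : 3 ≤ n := by omega
  have hfin : M.RankFinite := by
    have : M.Finite := ⟨hM.1 ▸ hE⟩
    infer_instance
  have hiff : M.IsNConnected 3 ↔ M.IsSimple ∧ G.nonloopsInNoTwoCycle.Subsingleton := by
    rw [h.nonloopsInNoTwoCycle_subsingleton_iff]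
    exact ⟨fun hc ↦ ⟨h.isSimple_of_isNConnected hn hM hfin hc,
      h.nontrivial_or_of_isNConnected hn hB hM hfin hc⟩,
      fun ⟨hS, hp⟩ ↦ h.isNConnected_three hn hB hM hS hp⟩
  refine ⟨hiff, fun hc ↦ ?_⟩
  obtain ⟨hS, hp⟩ := hiff.1 hc
  exact h.isUnbreakable hn hB hM hS (h.nonloopsInNoTwoCycle_subsingleton_iff.1 hp)
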